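/- Work over $\mathbf C$. For $m\ge 2$ let $G(2,m)\subset \mathbf P(\wedge^2\mathbf C^{m})$ be the Grassmannian of lines in $\mathbf P^{m-1}=\mathbf P(\mathbf C^{m})$ in its Plücker embedding. A rational normal curve of degree $d$ in a projective space is the image of the Veronese curve $\{(s^d:s^{d-1}t:\dots:t^d)\}\subset\mathbf P^d$ under a linear embedding of $\mathbf P^d$, and its tangent scroll is the union of its tangent lines. Let $g\in\{6,8\}$, let $C_g\subset G(2,g/2+2)$ be a rational normal curve of degree $g$ in the Plücker space, and assume that the tangent scroll $S_{2g-2}$ of $C_g$ is contained in $G(2,g/2+2)$. (i) If $g=6$, then there is a rational normal curve $C_4\subset\mathbf P^4$ of degree $4$ such that the lines $l\subset\mathbf P^4$, $l\in C_6$, are exactly the tangent lines to $C_4$; in particular they sweep out the tangent scroll of $C_4$. (ii) If $g=8$, and if there is a linear subspace $\mathbf P^9\subset\mathbf P^{14}$ such that the linear section $X_{14}=G(2,6)\cap\mathbf P^9$ has dimension $3$ and contains $S_{14}$, then there is a rational normal curve $C_5\subset\mathbf P^5$ of degree $5$ such that the lines $l\subset\mathbf P^5$, $l\in C_8$, are exactly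 the tangent lines to $C_5$; in particular they sweep out the tangent scroll of $C_5$. -/

import Mathlib

open scoped LinearAlgebra.Projectivization

noncomputable section

/-! Projective space of `V` is `ℙ ℂ V`, so `𝐏ⁿ` is `ℙ ℂ (Fin (n + 1) → ℂ)`; its points are the
one-dimensional subspaces `x.submodule` of `V`.  A line of the projective space is the
two-dimensional subspace `ℓ` of `V` over it, and `x` lies on it when `x.submodule ≤ ℓ`. -/

/-- The set of points of the linear subspace `𝐏(W)` of the projective space `𝐏(V)`. -/
def projLinear {V : Type*} [AddCommGroup V] [Module ℂ V] (W : Submodule ℂ V) : Set (ℙ ℂ V) :=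
  {x | x.submodule ≤ W}

/-- The monomials `s^d, s^(d-1) t, …, t^d` (with `s = X 0`, `t = X 1`), i.e. the coordinates of the
Veronese map `𝐏¹ → 𝐏^d`. -/
def veroneseForm (d : ℕ) (i : Fin (d + 1)) : MvPolynomial (Fin 2) ℂ :=
  MvPolynomial.X 0 ^ (d - (i : ℕ)) * MvPolynomial.X 1 ^ (i : ℕ)

/-- A rational normal curve of degree `d` in the projective space `𝐏(V)`, with a parametrization:
the image of the Veronese curve in `𝐏^d` under a linear embedding `𝐏^d → 𝐏(V)`. In particular
it spans a linear subspace of dimension `d`. -/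
structure RationalNormalCurve (d : ℕ) (V : Type*) [AddCommGroup V] [Module ℂ V] where
  /-- the linear embedding `ℂ^(d+1) → V` -/
  embed : (Fin (d + 1) → ℂ) →ₗ[ℂ] V
  embed_injective : Function.Injective embed

namespace RationalNormalCurve

/-- A vector representing the point of the curve with parameter `[p 0 : p 1]`. -/
def vec {d : ℕ} {V : Type*} [AddCommGroup V] [Module ℂ V] (C : RationalNormalCurve d V)
    (p : Fin 2 → ℂ) : V :=
  C.embed fun i => MvPolynomial.eval p (veroneseForm d i)

/-- The partial derivative of `C.vec` at `p` with respect to the variable number `k`. -/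
def partialVec {d : ℕ} {V : Type*} [AddCommGroup V] [Module ℂ V] (C : RationalNormalCurve d V)
    (k : Fin 2) (p : Fin 2 → ℂ) : V :=
  C.embed fun i => MvPolynomial.eval p (MvPolynomial.pderiv k (veroneseForm d i))

/-- The set of points of the curve. -/
def points {d : ℕ} {V : Type*} [AddCommGroup V] [Module ℂ V] (C : RationalNormalCurve d V) :
    Set (ℙ ℂ V) :=
  {x | ∃ p : Fin 2 → ℂ, p ≠ 0 ∧ x.submodule = Submodule.span ℂ {C.vec p}}

/-- The projective tangent line to the curve at the point with parameter `[p 0 : p 1]`: the image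
of the differential of the parametrization of the affine cone.  By Euler's formula it
contains the point itself. -/
def tangentLine {d : ℕ} {V : Type*} [AddCommGroup V] [Module ℂ V] (C : RationalNormalCurve d V)
    (p : Fin 2 → ℂ) : Submodule ℂ V :=
  Submodule.span ℂ {C.partialVec 0 p, C.partialVec 1 p}

/-- The set of all tangent lines to the curve. -/
def tangentLines {d : ℕ} {V : Type*} [AddCommGroup V] [Module ℂ V] (C : RationalNormalCurve d V) :
    Set (Submodule ℂ V) :=
  {ℓ | ∃ p : Fin 2 → ℂ, p ≠ 0 ∧ ℓ = C.tangentLine p}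

/-- The tangent scroll: the union of all the tangent lines to the curve. -/
def tangentScroll {d : ℕ} {V : Type*} [AddCommGroup V] [Module ℂ V] (C : RationalNormalCurve d V) :
    Set (ℙ ℂ V) :=
  ⋃ ℓ ∈ C.tangentLines, projLinear ℓ

end RationalNormalCurve

/-- `x ∈ 𝐏(⋀² V)` is the Plücker point of the line `ℓ` of `𝐏(V)`: `ℓ` is spanned by the
independent vectors `a`, `b` and `x = [a ∧ b]`. -/
def IsPluckerPoint {V : Type*} [AddCommGroup V] [Module ℂ V] (ℓ : Submodule ℂ V)
    (x : ℙ ℂ (⋀[ℂ]^2 V)) : Prop :=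
  ∃ a b : V, LinearIndependent ℂ ![a, b] ∧ ℓ = Submodule.span ℂ {a, b} ∧
    x.submodule = Submodule.span ℂ {exteriorPower.ιMulti ℂ 2 ![a, b]}

/-- The Grassmannian `G(2, V)` of lines in `𝐏(V)`, in its Plücker embedding in `𝐏(⋀² V)`. -/
def grassmannianOfLines (V : Type*) [AddCommGroup V] [Module ℂ V] : Set (ℙ ℂ (⋀[ℂ]^2 V)) :=
  {x | ∃ ℓ : Submodule ℂ V, IsPluckerPoint ℓ x}

/-- The lines of `𝐏(V)` that correspond to the points of a subset `C` of the Grassmannian. -/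
def linesOf {V : Type*} [AddCommGroup V] [Module ℂ V] (C : Set (ℙ ℂ (⋀[ℂ]^2 V))) :
    Set (Submodule ℂ V) :=
  {ℓ | ∃ x ∈ C, IsPluckerPoint ℓ x}

/-- The subset of `𝐏(V)` swept out by the lines `l ∈ C`, for a subset `C` of the Grassmannian. -/
def sweptOut {V : Type*} [AddCommGroup V] [Module ℂ V] (C : Set (ℙ ℂ (⋀[ℂ]^2 V))) :
    Set (ℙ ℂ V) :=
  ⋃ ℓ ∈ linesOf C, projLinear ℓ

/-- The Zariski topology on the projective space of a finite-dimensional space `V`, generated by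
the complements of the hypersurfaces `F = 0`.  Homogeneous forms on `V` are written without
coordinates, as homogeneous polynomials in linear functionals on `V`. -/
@[reducible] def zariskiTopology (V : Type*) [AddCommGroup V] [Module ℂ V] : TopologicalSpace (ℙ ℂ V) :=
  TopologicalSpace.generateFrom
    {U | ∃ (F : MvPolynomial (Module.Dual ℂ V) ℂ) (n : ℕ), F.IsHomogeneous n ∧
      U = {x : ℙ ℂ V | MvPolynomial.eval (fun f : Module.Dual ℂ V => f x.rep) F ≠ 0}}

/-- The dimension of a subset `X` of `𝐏(V)`: its Krull dimension in the Zariski topology. -/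
def zariskiDim {V : Type*} [AddCommGroup V] [Module ℂ V] (X : Set (ℙ ℂ V)) : WithBot ℕ∞ :=
  @topologicalKrullDim X (TopologicalSpace.induced Subtype.val (zariskiTopology V))

end

/-! Write g = 2k. The curve of lines is a polynomial matrix M(t) of skew matrices of rank two, of
degree at most 2k, with linearly independent coefficients. The scroll hypothesis says that every
combination of M(t) and M'(t) is decomposable: infinitely near lines meet. Following the meeting
point gives a directrix a, with M = a ∧ b and a' = r a + h b, so a ∧ a' = h M (`exists_directrix`).
If h were zero, a would be constant and all 2k+1 coefficients of M would lie in the image of y ↦ a ∧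
y, of dimension at most k+2 (`directrix_coeff_ne_zero`).

If the coordinates of a are independent, a degree count shows that h is constant and a has degree at
most k+1 (`natDegree_le_of_tangent_degree`). On one side, h^(k+1) divides the Wronskian of a, whose
degree is bounded by the degrees of the coordinates. On the other, a ∧ a' = h M bounds the sum of
the two largest of these degrees, in a basis of the coordinate span with distinct degrees. Hence a
parametrizes a rational normal curve and M is, up to a constant, its tangent line.

If the coordinates of a satisfy a linear relation, differentiating it and cancelling h gives the
same relation for b, so all lines lie in a hyperplane (`tangentLines_or_hyperplane`). For g = 6 the
span of the curve, of dimension 7, does not fit into ⋀²ℂ⁴. For g = 8 the span has dimension 9, hence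
is a hyperplane in ⋀²ℂ⁵, and it lies in the given ten-dimensional space. The linear section then
contains a hyperplane section of G(2,5), and so has dimension at least 4, not 3
(`four_le_zariskiDim`). -/

open Matrix

/-! ### Decomposable bivectors as skew matrices -/

/-- The skew-symmetric matrix `x yᵀ - y xᵀ` representing the bivector `x ∧ y`. -/
def wedgeMatrix {n R : Type*} [CommRing R] (x y : n → R) : Matrix n n R :=
  vecMulVec x y - vecMulVec y x

section WedgeMatrix

variable {n R : Type*} [CommRing R]

lemma wedgeMatrix_apply (x y : n → R) (i j : n) :
    wedgeMatrix x y i j = x i * y j - y i * x j := rfl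

lemma wedgeMatrix_map {S : Type*} [CommRing S] (φ : R →+* S) (x y : n → R) :
    (wedgeMatrix x y).map φ = wedgeMatrix (φ ∘ x) (φ ∘ y) := by
  ext i j; simp [wedgeMatrix_apply]

lemma wedgeMatrix_mulVec [Fintype n] (x y ξ : n → R) :
    wedgeMatrix x y *ᵥ ξ = (y ⬝ᵥ ξ) • x - (x ⬝ᵥ ξ) • y := by
  ext i
  simp only [mulVec, dotProduct, wedgeMatrix_apply, Pi.sub_apply, Pi.smul_apply, smul_eq_mul,
    Finset.sum_mul, ← Finset.sum_sub_distrib]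
  exact Finset.sum_congr rfl fun j _ => by ring

end WedgeMatrix

lemma linearIndependent_of_wedgeMatrix_ne_zero {n R : Type*} [CommRing R] [IsDomain R]
    {x y : n → R} (h : wedgeMatrix x y ≠ 0) :
    LinearIndependent R ![x, y] := by
  rw [LinearIndependent.pair_iff]
  intro s t hst
  have h1 : ∀ i, s * x i + t * y i = 0 := fun i => by simpa using congrFun hst i
  constructor <;> by_contra h0 <;> apply h <;> ext i j
  · have : s * (x i * y j - y i * x j) = 0 := by linear_combination y j * h1 i - y i * h1 j
    simpa [wedgeMatrix_apply, h0] using this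
  · have : t * (x i * y j - y i * x j) = 0 := by linear_combination x i * h1 j - x j * h1 i
    simpa [wedgeMatrix_apply, h0] using this

section Field

variable {n K : Type*} [Fintype n] [Field K]

/-- Coordinates with respect to linearly independent vectors are realised by dot products. -/
lemma LinearIndependent.exists_dotProduct_eq {ι : Type*} [Finite ι] {A : ι → n → K}
    (hA : LinearIndependent K A) (w : ι → K) : ∃ ξ : n → K, ∀ i, A i ⬝ᵥ ξ = w i := by
  classical
  obtain ⟨f, hf⟩ := LinearMap.exists_extend
    ((Module.Basis.span hA).constr K w : _ →ₗ[K] K)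
  refine ⟨fun j => f (Pi.single j 1), fun i => ?_⟩
  have h1 : f (A i) = w i := by
    have h2 := congrArg (fun g => g (Module.Basis.span hA i)) hf
    simp only [Module.Basis.constr_basis, LinearMap.comp_apply] at h2
    simpa [Module.Basis.span_apply] using h2
  rw [← h1]
  conv_rhs => rw [pi_eq_sum_univ' (A i)]
  simp [dotProduct]

lemma range_mulVecLin_wedgeMatrix_le (x y : n → K) :
    LinearMap.range (wedgeMatrix x y).mulVecLin ≤ Submodule.span K {x, y} := by
  rintro _ ⟨ξ, rfl⟩
  rw [mulVecLin_apply, wedgeMatrix_mulVec]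
  exact sub_mem (Submodule.smul_mem _ _ (Submodule.subset_span (by simp)))
    (Submodule.smul_mem _ _ (Submodule.subset_span (by simp)))

/-- Contracting with functionals dual to the pair produces each of the two vectors, so the matrix
remembers the line. -/
lemma range_mulVecLin_wedgeMatrix {x y : n → K} (h : LinearIndependent K ![x, y]) :
    LinearMap.range (wedgeMatrix x y).mulVecLin = Submodule.span K {x, y} := by
  apply le_antisymm
  · exact range_mulVecLin_wedgeMatrix_le x y
  · rw [Submodule.span_le]
    rintro _ (rfl | rfl)
    · obtain ⟨ξ, hξ⟩ := h.exists_dotProduct_eq ![0, 1]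
      have h0 := hξ 0
      have h1 := hξ 1
      simp only [cons_val_zero, cons_val_one] at h0 h1
      exact ⟨ξ, by rw [mulVecLin_apply, wedgeMatrix_mulVec, h0, h1]; simp⟩
    · obtain ⟨ξ, hξ⟩ := h.exists_dotProduct_eq ![-1, 0]
      have h0 := hξ 0
      have h1 := hξ 1
      simp only [cons_val_zero, cons_val_one] at h0 h1
      exact ⟨ξ, by rw [mulVecLin_apply, wedgeMatrix_mulVec, h0, h1]; simp⟩

/-- The bivector `p ∧ v + u ∧ q` is indecomposable when `u, v, p, q` are independent. -/
lemma wedgeMatrix_add_ne_wedgeMatrix {u v p q : n → K}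
    (h : LinearIndependent K ![u, v, p, q]) (x y : n → K) :
    wedgeMatrix p v + wedgeMatrix u q ≠ wedgeMatrix x y := by
  intro he
  -- The image of the left side contains every such combination, since the products of ξ with u, v,
  -- p, q can be prescribed. It is therefore four-dimensional, while the image of x ∧ y is at most a
  -- plane.
  have key : ∀ w : Fin 4 → K, w 1 • p - w 2 • v + (w 3 • u - w 0 • q) ∈
      Submodule.span K {x, y} := by
    intro w
    obtain ⟨ξ, hξ⟩ := h.exists_dotProduct_eq w
    have h0 := hξ 0
    have h1 := hξ 1
    have h2 := hξ 2
    have h3 := hξ 3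
    simp only [cons_val] at h0 h1 h2 h3
    apply range_mulVecLin_wedgeMatrix_le x y
    refine ⟨ξ, ?_⟩
    rw [mulVecLin_apply, ← he, add_mulVec, wedgeMatrix_mulVec, wedgeMatrix_mulVec, h0, h1, h2, h3]
  have hle : Submodule.span K (Set.range ![u, v, p, q]) ≤ Submodule.span K {x, y} := by
    rw [Submodule.span_le]
    rintro _ ⟨i, rfl⟩
    fin_cases i
    · simpa using key ![0, 0, 0, 1]
    · simpa using key ![0, 0, 1, 0]
    · simpa using key ![0, 1, 0, 0]
    · simpa using key ![1, 0, 0, 0]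
  have h4 := finrank_span_eq_card h
  have h2 : Module.finrank K (Submodule.span K ({x, y} : Set (n → K))) ≤ 2 := by
    have := finrank_range_le_card (R := K) ![x, y]
    rwa [Set.finrank, range_cons, range_cons, range_empty, Set.union_empty,
      Set.singleton_union] at this
  have := Submodule.finrank_mono hle
  simp at h4
  omega

end Field

/-! ### Vectors of polynomials: specialization and content -/

section Polynomial

open Polynomial

/-- Polynomial vectors that are independent over the polynomial ring stay independent for
some value of the variable. -/
lemma LinearIndependent.exists_eval {K : Type*} [Field K] [Infinite K] {k : ℕ} {n : Type*}
    [Fintype n] {A : Fin k → n → K[X]} (hA : LinearIndependent K[X] A) :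
    ∃ t : K, LinearIndependent K fun i j => (A i j).eval t := by
  classical
  have hF : LinearIndependent (FractionRing K[X])
      fun i j => algebraMap K[X] (FractionRing K[X]) (A i j) := by
    rw [← LinearIndependent.iff_fractionRing (R := K[X])]
    refine (hA.map' ((Algebra.linearMap K[X] (FractionRing K[X])).compLeft n) ?_)
    rw [LinearMap.ker_eq_bot]
    intro x y hxy
    ext1 j
    exact IsFractionRing.injective K[X] (FractionRing K[X]) (congrFun hxy j)
  -- Dual vectors over the fraction field, cleared by a common denominator δ, certify independence
  -- wherever δ does not vanish.
  choose ξ hξ using fun l : Fin k => hF.exists_dotProduct_eq (Pi.single l 1)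
  obtain ⟨δ, hδ⟩ := IsLocalization.exist_integer_multiples_of_finite (nonZeroDivisors K[X])
    (fun p : Fin k × n => ξ p.1 p.2)
  choose η hη using hδ
  have hdot : ∀ l i, ∑ j, A i j * η (l, j) = if i = l then (δ : K[X]) else 0 := by
    intro l i
    apply IsFractionRing.injective K[X] (FractionRing K[X])
    have := hξ l i
    simp only [dotProduct, Pi.single_apply] at this
    simp only [map_sum, map_mul, hη, Algebra.smul_def, mul_left_comm, ← Finset.mul_sum, this]
    split_ifs <;> simp
  obtain ⟨t, ht⟩ : ∃ t, (δ : K[X]).eval t ≠ 0 := by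
    by_contra! h
    exact nonZeroDivisors.coe_ne_zero δ (Polynomial.funext (by simpa using h))
  refine ⟨t, ?_⟩
  rw [Fintype.linearIndependent_iff]
  intro g hg l
  have h1 : ∀ j, ∑ i, g i * (A i j).eval t = 0 := fun j => by simpa using congrFun hg j
  have h2 : ∑ i, g i * ∑ j, (A i j).eval t * (η (l, j)).eval t = 0 := by
    simp only [Finset.mul_sum]
    rw [Finset.sum_comm]
    simp only [← mul_assoc, ← Finset.sum_mul, h1, zero_mul, Finset.sum_const_zero]
  have h3 : ∀ i, ∑ j, (A i j).eval t * (η (l, j)).eval t =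
      if i = l then (δ : K[X]).eval t else 0 := fun i => by
    have := congrArg (Polynomial.eval t) (hdot l i)
    simp only [eval_finsetSum, eval_mul] at this
    rw [this]; split_ifs <;> simp
  simp only [h3, mul_ite, mul_zero, Finset.sum_ite_eq', Finset.mem_univ, if_true] at h2
  exact (mul_eq_zero.1 h2).resolve_right ht

/-- A nonzero polynomial vector is a multiple of a unimodular one. -/
lemma exists_eq_smul_unimodular {K : Type*} [Field K] {n : Type*} [Fintype n] {v : n → K[X]}
    (hv : v ≠ 0) : ∃ (π : K[X]) (a ξ : n → K[X]), π ≠ 0 ∧ v = π • a ∧ a ⬝ᵥ ξ = 1 := by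
  classical
  -- π is the gcd of the coordinates; a Bézout relation supplies ξ.
  obtain ⟨π, hπ⟩ := IsPrincipalIdealRing.principal (Ideal.span (Set.range v))
  have hπ' : Ideal.span (Set.range v) = Ideal.span {π} := hπ
  have hdvd : ∀ i, ∃ c, v i = π * c := fun i => by
    have : v i ∈ Ideal.span {π} := hπ' ▸ Ideal.subset_span ⟨i, rfl⟩
    exact Ideal.mem_span_singleton.1 this
  choose a ha using hdvd
  have hmem : π ∈ Ideal.span (Set.range v) := hπ' ▸ Ideal.mem_span_singleton_self π
  obtain ⟨ξ, hξ⟩ := (Ideal.mem_span_range_iff_exists_fun).1 hmem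
  have hπ0 : π ≠ 0 := by
    rintro rfl
    exact hv (funext fun i => by simp [ha])
  refine ⟨π, a, ξ, hπ0, funext ha, ?_⟩
  apply mul_left_cancel₀ hπ0
  rw [mul_one]
  conv_rhs => rw [← hξ]
  simp only [dotProduct, Finset.mul_sum, ha]
  exact Finset.sum_congr rfl fun i _ => by ring

end Polynomial

/-! ### Developable families of lines and their directrix -/

section Developable

open Polynomial

/-- The polynomial matrix `∑ c k X ^ k`. -/
noncomputable def polyMatrix {n K : Type*} [CommRing K] {d : ℕ} (c : Fin d → Matrix n n K) :
    Matrix n n K[X] :=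
  Matrix.of fun i j => ∑ k, C (c k i j) * X ^ (k : ℕ)

/-- The entrywise derivative of a polynomial vector. -/
noncomputable def derivVec {n K : Type*} [CommRing K] (a : n → K[X]) : n → K[X] :=
  fun i => derivative (a i)

variable {n K : Type*} [Field K]

lemma polyMatrix_apply {d : ℕ} (c : Fin d → Matrix n n K) (i j : n) :
    polyMatrix c i j = ∑ k, C (c k i j) * X ^ (k : ℕ) := rfl

lemma coeff_polyMatrix {d : ℕ} (c : Fin d → Matrix n n K) (i j : n) (k : Fin d) :
    (polyMatrix c i j).coeff k = c k i j := by
  simp [polyMatrix_apply, coeff_C_mul, coeff_X_pow, Fin.val_inj]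

lemma natDegree_polyMatrix_le {d : ℕ} (c : Fin (d + 1) → Matrix n n K) (i j : n) :
    (polyMatrix c i j).natDegree ≤ d := by
  rw [polyMatrix_apply]
  exact natDegree_sum_le_of_forall_le _ _ fun k _ =>
    (natDegree_C_mul_X_pow_le _ _).trans (Nat.lt_succ_iff.1 k.2)

lemma derivVec_smul (p : K[X]) (a : n → K[X]) :
    derivVec (p • a) = derivative p • a + p • derivVec a := by
  ext1 i; simp [derivVec]

lemma derivVec_add (a b : n → K[X]) : derivVec (a + b) = derivVec a + derivVec b := by
  ext1 i; simp [derivVec]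

variable [Fintype n]

/-- The functional picks out the constant coefficient and kills the others. It makes M primitive:
from p N = q M one reads off q = p L(N), so p divides q. -/
lemma exists_functional_polyMatrix_eq_one {d : ℕ} {c : Fin (d + 1) → Matrix n n K}
    (hc : LinearIndependent K c) :
    ∃ L : Matrix n n K[X] →ₗ[K[X]] K[X], L (polyMatrix c) = 1 := by
  classical
  have hc' : LinearIndependent K fun k (p : n × n) => c k p.1 p.2 :=
    hc.map' ((LinearEquiv.curry K K n n).symm : (n → n → K) →ₗ[K] (n × n → K))
      (LinearEquiv.ker _)
  obtain ⟨l, hl⟩ := hc'.exists_dotProduct_eq (Pi.single 0 1)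
  refine ⟨∑ p : n × n, C (l p) • Matrix.entryLinearMap K[X] K[X] p.1 p.2, ?_⟩
  have : ∀ k, ∑ p : n × n, C (l p) * C (c k p.1 p.2) = if k = 0 then 1 else 0 := fun k => by
    have h := hl k
    simp only [dotProduct, Pi.single_apply] at h
    simp only [← C_mul, ← map_sum, mul_comm (l _), h]
    split_ifs <;> simp
  simp only [LinearMap.sum_apply, LinearMap.smul_apply, Matrix.entryLinearMap_apply,
    polyMatrix_apply, smul_eq_mul, Finset.mul_sum]
  rw [Finset.sum_comm]
  simp only [← mul_assoc, ← Finset.sum_mul, this]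
  simp

variable [Infinite K]

-- At each t this is the Plücker relation for a rank-two skew matrix; an identity at all points of
-- an infinite field is an identity of polynomials.
omit [Fintype n] in
lemma polyMatrix_minors {d : ℕ} {c : Fin d → Matrix n n K}
    (hdec : ∀ t : K, ∃ x y, (polyMatrix c).map (eval t) = wedgeMatrix x y) (i j : n) :
    polyMatrix c i j • polyMatrix c = wedgeMatrix (polyMatrix c i) (polyMatrix c j) := by
  ext1 k l
  apply Polynomial.funext
  intro t
  obtain ⟨x, y, hxy⟩ := hdec t
  have h : ∀ a b, (polyMatrix c a b).eval t = x a * y b - y a * x b := fun a b => congrFun (congrFun hxy a) b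
  simp only [Matrix.smul_apply, smul_eq_mul, eval_mul, wedgeMatrix_apply, eval_sub, h]
  ring

/-- A curve of decomposable bivectors all of whose tangent vectors are decomposable too
is of the form `a ∧ c` where `a'` is a combination of `a` and `c`. -/
theorem exists_directrix {d : ℕ} {c : Fin (d + 1) → Matrix n n K} (hc : LinearIndependent K c)
    (hdec : ∀ α β t : K, ∃ x y, α • (polyMatrix c).map (eval t) +
      β • (polyMatrix c).map (fun p => eval t (derivative p)) = wedgeMatrix x y) :
    ∃ (a b : n → K[X]) (r h : K[X]), polyMatrix c = wedgeMatrix a b ∧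
      derivVec a = r • a + h • b := by
  classical
  set M := polyMatrix c with hM
  obtain ⟨L, hL⟩ := exists_functional_polyMatrix_eq_one hc
  have hdec0 : ∀ t : K, ∃ x y, M.map (eval t) = wedgeMatrix x y := fun t => by
    simpa using hdec 1 0 t
  have hM0 : M ≠ 0 := by
    intro h; rw [← hM, h] at hL; simp at hL
  obtain ⟨i, j, hij⟩ : ∃ i j, M i j ≠ 0 := by
    by_contra! h; exact hM0 (by ext1 i j; exact h i j)
  have hmin := polyMatrix_minors hdec0 i j
  rw [← hM] at hmin
  set κ := M i j with hκ
  set u := M i with hu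
  set v := M j with hv
  have huv0 : wedgeMatrix u v ≠ 0 := hmin ▸ smul_ne_zero hij hM0
  have huv := linearIndependent_of_wedgeMatrix_ne_zero huv0
  -- Differentiating κ M = u ∧ v gives κ' M + κ M' = u' ∧ v + u ∧ v'. At a value t where the four
  -- vectors are independent the right side is indecomposable, against `hdec` with weights κ'(t),
  -- κ(t).
  have hdep : ¬ LinearIndependent K[X] ![u, v, derivVec u, derivVec v] := by
    intro hli
    obtain ⟨t, ht⟩ := hli.exists_eval
    have hli' : LinearIndependent K ![fun k => (u k).eval t, fun k => (v k).eval t,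
        fun k => (derivative (u k)).eval t, fun k => (derivative (v k)).eval t] := by
      convert ht using 1
      ext i k
      fin_cases i <;> rfl
    obtain ⟨x, y, hxy⟩ := hdec ((derivative κ).eval t) (κ.eval t) t
    refine wedgeMatrix_add_ne_wedgeMatrix hli' x y ?_
    rw [← hxy]
    ext k l
    have h1 := congrArg (fun p => eval t (derivative p)) (congrFun (congrFun hmin k) l)
    simp only [Matrix.smul_apply, smul_eq_mul, derivative_mul, eval_add, eval_mul,
      wedgeMatrix_apply, derivative_sub, eval_sub] at h1
    simp only [Matrix.add_apply, Matrix.smul_apply, smul_eq_mul, wedgeMatrix_apply,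
      Matrix.map_apply]
    rw [h1]; ring
  obtain ⟨g, hg, hg0⟩ := Fintype.not_linearIndependent_iff.1 hdep
  simp only [Fin.sum_univ_four, cons_val] at hg
  -- The derivative of g₂ u + g₃ v is again a combination of u and v, because the relation removes
  -- u' and v'. This vector is therefore the directrix, up to its content π.
  have ha0 : g 2 • u + g 3 • v ≠ 0 := by
    intro h
    obtain ⟨h2, h3⟩ := LinearIndependent.pair_iff.1 huv _ _ h
    rw [h2, h3, zero_smul, zero_smul, add_zero, add_zero] at hg
    obtain ⟨h0, h1⟩ := LinearIndependent.pair_iff.1 huv _ _ hg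
    obtain ⟨i, hi⟩ := hg0
    fin_cases i <;> simp_all
  obtain ⟨π, a, ξ, hπ, haπ, hξ⟩ := exists_eq_smul_unimodular ha0
  have hak : ∀ k, g 2 * u k + g 3 * v k = π * a k := fun k => by simpa using congrFun haπ k
  have hgk : ∀ k, g 0 * u k + g 1 * v k + g 2 * derivative (u k) + g 3 * derivative (v k) = 0 :=
    fun k => by simpa [derivVec] using congrFun hg k
  have hmk : ∀ k l, κ * M k l = u k * v l - v k * u l := fun k l => by
    simpa [wedgeMatrix_apply] using congrFun (congrFun hmin k) l
  have hdk : ∀ k, derivative π * a k + π * derivative (a k) =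
      (derivative (g 2) - g 0) * u k + (derivative (g 3) - g 1) * v k := fun k => by
    have h1 := congrArg derivative (hak k)
    simp only [derivative_mul, map_add] at h1
    linear_combination hgk k - h1
  -- η is the determinant expressing πa and (πa)' in u and v, so π² a ∧ a' = η u ∧ v = ηκ M; then L
  -- shows that π² divides ηκ.
  set η := g 2 * (derivative (g 3) - g 1) - g 3 * (derivative (g 2) - g 0) with hη
  have hπ2 : (π ^ 2) • wedgeMatrix a (derivVec a) = (η * κ) • M := by
    ext1 k l
    simp only [Matrix.smul_apply, smul_eq_mul, wedgeMatrix_apply, derivVec]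
    have e : π ^ 2 * (a k * derivative (a l) - derivative (a k) * a l) =
        (π * a k) * (derivative π * a l + π * derivative (a l)) -
        (derivative π * a k + π * derivative (a k)) * (π * a l) := by ring
    rw [e, ← hak, ← hak, hdk, hdk]
    linear_combination (-η) * hmk k l
  set h := L (wedgeMatrix a (derivVec a)) with hh
  have hη2 : η * κ = π ^ 2 * h := by
    have := congrArg L hπ2
    rw [map_smul, map_smul, hL, smul_eq_mul, smul_eq_mul, mul_one] at this
    exact this.symm
  have hwa : wedgeMatrix a (derivVec a) = h • M := by
    apply smul_right_injective _ (pow_ne_zero 2 hπ)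
    simp only
    rw [hπ2, hη2, mul_smul]
  -- Since a · ξ = 1, contracting a bivector a ∧ y with ξ returns −y modulo a; so −Mξ is the
  -- candidate for the second generator.
  set b : n → K[X] := -(M *ᵥ ξ) with hb
  have hMb : M = wedgeMatrix a b := by
    have hκξ : ∀ k, κ * b k = (u ⬝ᵥ ξ) * v k - (v ⬝ᵥ ξ) * u k := fun k => by
      have h1 := congrFun (congrArg (· *ᵥ ξ) hmin) k
      simp only [wedgeMatrix_mulVec, smul_mulVec] at h1
      simp only [Pi.smul_apply, smul_eq_mul, Pi.sub_apply] at h1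
      simp only [hb, Pi.neg_apply]
      linear_combination -h1
    have hπξ : π = g 2 * (u ⬝ᵥ ξ) + g 3 * (v ⬝ᵥ ξ) := by
      have h1 := congrArg (· ⬝ᵥ ξ) haπ
      simp only [add_dotProduct, smul_dotProduct, hξ, smul_eq_mul, mul_one] at h1
      exact h1.symm
    ext1 k l
    apply mul_left_cancel₀ (mul_ne_zero hπ hij)
    have e : π * κ * (a k * b l - b k * a l) =
      (π * a k) * (κ * b l) - (κ * b k) * (π * a l) := by ring
    rw [wedgeMatrix_apply, e, ← hak, ← hak, hκξ, hκξ]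
    linear_combination π * hmk k l + (u k * v l - v k * u l) * hπξ
  -- r is read off by contracting a ∧ a' = h a ∧ b with ξ.
  refine ⟨a, b, derivVec a ⬝ᵥ ξ - h * (b ⬝ᵥ ξ), h, hMb, ?_⟩
  have h1 := congrArg (· *ᵥ ξ) hwa
  rw [hMb] at h1
  simp only [smul_mulVec, wedgeMatrix_mulVec, hξ, one_smul] at h1
  ext1 k
  have h2 := congrFun h1 k
  simp only [Pi.sub_apply, Pi.smul_apply, smul_eq_mul] at h2
  simp only [Pi.add_apply, Pi.smul_apply, smul_eq_mul]
  linear_combination -h2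

omit [Infinite K] in
/-- If the directrix is a point, the bivectors span a space of dimension at most `n`. -/
lemma directrix_coeff_ne_zero [CharZero K] {d : ℕ} {c : Fin d → Matrix n n K}
    (hc : LinearIndependent K c) (hd : Fintype.card n < d) {a b : n → K[X]} {r h : K[X]}
    (hM : polyMatrix c = wedgeMatrix a b) (hab : derivVec a = r • a + h • b) : h ≠ 0 := by
  rintro rfl
  rw [zero_smul, add_zero] at hab
  -- A nonzero derivative has smaller degree than a i, so it cannot be a multiple of it.
  have hda : ∀ i, derivative (a i) = 0 := by
    intro i
    have hi : derivative (a i) = r * a i := congrFun hab i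
    by_cases hai : a i = 0
    · rw [hai, derivative_zero]
    · by_contra h0
      have h1 := degree_derivative_lt hai
      rw [hi] at h1 h0
      rw [mul_comm] at h1
      exact absurd h1 (not_lt.2 (degree_le_mul_left _ (left_ne_zero_of_mul h0)))
  have hconst : ∀ i, a i = C ((a i).coeff 0) := fun i =>
    eq_C_of_natDegree_eq_zero (derivative_eq_zero.1 (hda i))
  let T : (n → K) →ₗ[K] Matrix n n K :=
    { toFun := fun y => wedgeMatrix (fun i => (a i).coeff 0) y
      map_add' := fun y z => by ext; simp [wedgeMatrix_apply]; ring
      map_smul' := fun s y => by ext; simp [wedgeMatrix_apply]; ring }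
  have hcT : ∀ k, c k = T fun i => (b i).coeff k := fun k => by
    ext i j
    rw [← coeff_polyMatrix c i j k, hM, wedgeMatrix_apply, hconst i, hconst j]
    simp [T, wedgeMatrix_apply]
  have : LinearIndependent K fun k : Fin d => fun i => (b i).coeff k := by
    apply LinearIndependent.of_comp T
    convert hc using 1
    exact funext fun k => (hcT k).symm
  have := this.fintype_card_le_finrank
  simp at this
  omega

end Developable

/-! ### Wronskians: degree bound and divisibility -/

section Wronskian

open Polynomial

section Degree

variable {R : Type*} [CommRing R]

/-- X^i Dⁱ is diagonal on monomials with falling factorials as eigenvalues. Scaling the rows of the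
Wronskian this way gives all entries of a column the same degree bound. -/
lemma coeff_X_pow_mul_iterate_derivative (p : R[X]) (i n : ℕ) :
    (X ^ i * derivative^[i] p).coeff n = n.descFactorial i * p.coeff n := by
  rw [coeff_X_pow_mul']
  split_ifs with h
  · rw [coeff_iterate_derivative, Nat.sub_add_cancel h, nsmul_eq_mul]
  · rw [Nat.descFactorial_of_lt (not_le.1 h)]; simp

lemma natDegree_X_pow_mul_iterate_derivative_le (p : R[X]) (i : ℕ) :
    (X ^ i * derivative^[i] p).natDegree ≤ p.natDegree := by
  rw [natDegree_le_iff_coeff_eq_zero]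
  intro n hn
  rw [coeff_X_pow_mul_iterate_derivative, coeff_eq_zero_of_natDegree_lt hn, mul_zero]

lemma coeff_prod_sum_of_natDegree_le {ι : Type*} (s : Finset ι) (f : ι → R[X]) (e : ι → ℕ)
    (h : ∀ i ∈ s, (f i).natDegree ≤ e i) :
    (∏ i ∈ s, f i).coeff (∑ i ∈ s, e i) = ∏ i ∈ s, (f i).coeff (e i) := by
  classical
  induction s using Finset.induction_on with
  | empty => simp
  | insert i s hi ih =>
    have hs : ∀ j ∈ s, (f j).natDegree ≤ e j := fun j hj => h j (Finset.mem_insert_of_mem hj)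
    rw [Finset.prod_insert hi, Finset.sum_insert hi, Finset.prod_insert hi,
      coeff_mul_add_eq_of_natDegree_le (h i (Finset.mem_insert_self _ _))
        ((natDegree_prod_le _ _).trans (Finset.sum_le_sum hs)), ih hs]

variable {n : Type*} [Fintype n] [DecidableEq n]

lemma natDegree_det_le_sum (A : Matrix n n R[X]) (e : n → ℕ) (h : ∀ i j, (A i j).natDegree ≤ e j) :
    A.det.natDegree ≤ ∑ j, e j := by
  rw [det_apply]
  refine natDegree_sum_le_of_forall_le _ _ fun σ _ => ?_
  rw [Units.smul_def, zsmul_eq_mul, ← C_eq_intCast]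
  exact (natDegree_C_mul_le _ _).trans
    ((natDegree_prod_le _ _).trans (Finset.sum_le_sum fun j _ => h _ _))

lemma coeff_det_sum (A : Matrix n n R[X]) (e : n → ℕ) (h : ∀ i j, (A i j).natDegree ≤ e j) :
    A.det.coeff (∑ j, e j) = (Matrix.of fun i j => (A i j).coeff (e j)).det := by
  rw [det_apply, det_apply, finsetSum_coeff]
  refine Finset.sum_congr rfl fun σ _ => ?_
  rw [Units.smul_def, Units.smul_def, coeff_smul,
    coeff_prod_sum_of_natDegree_le _ _ _ fun j _ => h _ _]
  rfl

end Degree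

/-- The Wronskian matrix of a family of polynomials. -/
noncomputable def wronskianMatrix {R : Type*} [CommRing R] {m : ℕ} (a : Fin m → R[X]) :
    Matrix (Fin m) (Fin m) R[X] :=
  Matrix.of fun i j => derivative^[i] (a j)

variable {K : Type*} [Field K]

/-- After row i is scaled by X^i, the top coefficient of the determinant is the product of the
leading coefficients and a determinant of falling factorials of the degrees. The latter is a
Vandermonde determinant, nonzero in characteristic zero when the degrees are distinct. The scaling
accounts for the sum of the i. -/
lemma wronskianMatrix_det_ne_zero [CharZero K] {m : ℕ} {a : Fin m → K[X]} (ha : ∀ i, a i ≠ 0)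
    (hinj : Function.Injective fun i => (a i).natDegree) :
    (wronskianMatrix a).det ≠ 0 ∧
      (wronskianMatrix a).det.natDegree + ∑ i : Fin m, (i : ℕ) ≤ ∑ i, (a i).natDegree := by
  set N : Matrix (Fin m) (Fin m) K[X] :=
    Matrix.of fun i j => X ^ (i : ℕ) * wronskianMatrix a i j with hN
  have hNdet : N.det = X ^ (∑ i : Fin m, (i : ℕ)) * (wronskianMatrix a).det := by
    rw [hN, det_mul_column, Finset.prod_pow_eq_pow_sum]
  have hdeg : ∀ i j, (N i j).natDegree ≤ (a j).natDegree := fun i j =>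
    natDegree_X_pow_mul_iterate_derivative_le _ _
  have hcoeff := coeff_det_sum N _ hdeg
  have hlead : (Matrix.of fun i j => (N i j).coeff (a j).natDegree).det ≠ 0 := by
    have e : (Matrix.of fun i j => (N i j).coeff (a j).natDegree) =
        Matrix.of fun i j => (a j).leadingCoeff *
          (Matrix.of fun i j : Fin m =>
            (descPochhammer K j).eval (((a i).natDegree : ℕ) : K))ᵀ i j := by
      ext i j
      simp only [hN, of_apply, transpose_apply, wronskianMatrix]
      rw [coeff_X_pow_mul_iterate_derivative, descPochhammer_eval_eq_descFactorial,
        mul_comm, leadingCoeff]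
    rw [e, det_mul_row, det_transpose, ← det_eval_matrixOfPolynomials_eq_det_vandermonde _
      (fun j : Fin m => descPochhammer K j) (fun j => descPochhammer_natDegree _ _)
      (fun j => monic_descPochhammer _ _)]
    refine mul_ne_zero (Finset.prod_ne_zero_iff.2 fun i _ => leadingCoeff_ne_zero.2 (ha i)) ?_
    rw [det_vandermonde_ne_zero_iff]
    exact fun i j hij => hinj (Nat.cast_injective hij)
  rw [← hcoeff] at hlead
  have hN0 : N.det ≠ 0 := fun h => hlead (by rw [h, coeff_zero])
  have hW0 : (wronskianMatrix a).det ≠ 0 := right_ne_zero_of_mul (hNdet ▸ hN0)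
  refine ⟨hW0, ?_⟩
  have := natDegree_det_le_sum N _ hdeg
  rwa [hNdet, natDegree_mul (pow_ne_zero _ X_ne_zero) hW0, natDegree_X_pow, add_comm] at this

lemma iterate_derivVec_apply {n R : Type*} [CommRing R] (a : n → R[X]) (i : ℕ) (j : n) :
    (derivVec^[i] a) j = derivative^[i] (a j) := by
  induction i generalizing a with
  | zero => rfl
  | succ i ih => rw [Function.iterate_succ_apply, ih]; rfl

/-- If `a' ≡ h b` modulo `a`, the derivatives of `a` are triangular in `a, b, b', b'', …`. -/
lemma iterate_derivVec_eq {n : Type*} {a b : n → K[X]} {r h : K[X]}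
    (hab : derivVec a = r • a + h • b) (i : ℕ) :
    ∃ f : ℕ → K[X], derivVec^[i] a = (if i = 0 then (1 : K[X]) else h) •
      (if i = 0 then a else derivVec^[i - 1] b) +
        ∑ l ∈ Finset.range i, f l • (if l = 0 then a else derivVec^[l - 1] b) := by
  -- D lists a, b, b', b'', …, and S i is spanned by its first i terms. Differentiation maps S i
  -- into S (i + 1); the factor h enters with a' and persists as the coefficient of the last term.
  set D : ℕ → n → K[X] := fun l => if l = 0 then a else derivVec^[l - 1] b with hD
  set S : ℕ → Submodule K[X] (n → K[X]) := fun i => Submodule.span K[X] (D '' Finset.range i)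
    with hS
  have hmem : ∀ {l i}, l < i → D l ∈ S i := fun hl =>
    Submodule.subset_span ⟨_, by simpa using hl, rfl⟩
  have hmono : ∀ {i j}, i ≤ j → S i ≤ S j := fun hij =>
    Submodule.span_mono (Set.image_mono (by simpa using Set.Iio_subset_Iio hij))
  have hDs : ∀ l, derivVec (D (l + 1)) = D (l + 2) := fun l => by
    simp only [hD, Nat.add_eq_zero_iff, one_ne_zero, and_false, if_false, OfNat.ofNat_ne_zero]
    rw [← Function.iterate_succ_apply' derivVec]
    rfl
  have hD' : ∀ l, derivVec (D l) ∈ S (l + 2) := fun l => by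
    rcases l with _ | l
    · have : derivVec (D 0) = r • D 0 + h • D 1 := by simpa [hD] using hab
      rw [this]
      exact add_mem (Submodule.smul_mem _ _ (hmem (by omega)))
        (Submodule.smul_mem _ _ (hmem (by omega)))
    · rw [hDs]; exact hmem (by omega)
  have hder : ∀ i x, x ∈ S i → derivVec x ∈ S (i + 1) := by
    intro i x hx
    induction hx using Submodule.span_induction with
    | mem x hx =>
      obtain ⟨l, hl, rfl⟩ := hx
      exact hmono (by have := Finset.mem_range.1 (Finset.mem_coe.1 hl); omega) (hD' l)
    | zero =>
      have : derivVec (0 : n → K[X]) = 0 := by ext1 i; simp [derivVec]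
      rw [this]; exact zero_mem _
    | add x y _ _ hx hy => rw [derivVec_add]; exact add_mem hx hy
    | smul p x hx' hx =>
      rw [derivVec_smul]
      exact add_mem (Submodule.smul_mem _ _ (hmono (Nat.le_succ i) hx')) (Submodule.smul_mem _ _ hx)
  have key : ∀ i, derivVec^[i] a - (if i = 0 then (1 : K[X]) else h) • D i ∈ S i := by
    intro i
    rcases i with _ | i
    · simp [hD]
    · simp only [Nat.add_eq_zero_iff, one_ne_zero, and_false, if_false]
      induction i with
      | zero =>
        have : derivVec^[0 + 1] a - h • D (0 + 1) = r • D 0 := by simp [hD, hab]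
        rw [this]
        exact Submodule.smul_mem _ _ (hmem (by omega))
      | succ i ih =>
        have e : derivVec^[i + 1 + 1] a - h • D (i + 1 + 1) =
            derivVec (derivVec^[i + 1] a - h • D (i + 1)) + derivative h • D (i + 1) := by
          have e1 : derivVec^[i + 1] a = (derivVec^[i + 1] a - h • D (i + 1)) + h • D (i + 1) := by
            abel
          rw [Function.iterate_succ_apply']
          conv_lhs => rw [e1, derivVec_add, derivVec_smul, hDs]
          abel
        rw [e]
        exact add_mem (hder _ _ ih) (Submodule.smul_mem _ _ (hmem (by omega)))
  obtain ⟨f, hf⟩ := (Submodule.mem_span_image_finset_iff_exists_fun' K[X]).1 (key i)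
  exact ⟨f, by rw [hf]; abel⟩

/-- The passage from a, b, b', … to a, a', a'', … is lower triangular with diagonal 1, h, …, h. -/
lemma pow_dvd_det_wronskianMatrix {k : ℕ} {a b : Fin (k + 1) → K[X]} {r h : K[X]}
    (hab : derivVec a = r • a + h • b) : h ^ k ∣ (wronskianMatrix a).det := by
  choose f hf using iterate_derivVec_eq hab
  set D : ℕ → Fin (k + 1) → K[X] := fun l => if l = 0 then a else derivVec^[l - 1] b with hD
  let T : Matrix (Fin (k + 1)) (Fin (k + 1)) K[X] := Matrix.of fun i l =>
    if l < i then f i l else if l = i then (if i = 0 then 1 else h) else 0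
  have hW : wronskianMatrix a = T * Matrix.of fun (l : Fin (k + 1)) j => D l j := by
    ext1 i j
    have h1 := congrFun (hf i) j
    rw [iterate_derivVec_apply] at h1
    simp only [wronskianMatrix, of_apply, h1, Matrix.mul_apply, T]
    have h2 : ∀ l : Fin (k + 1), (if l < i then f i l else if l = i then
        (if i = 0 then 1 else h) else 0) * D l j =
        (if l = i then (if i = 0 then 1 else h) * D i j else 0) +
        (if (l : ℕ) < i then f i l * D l j else 0) := by
      intro l
      rcases lt_trichotomy l i with hl | rfl | hl
      · simp [hl, hl.ne, Fin.lt_def.1 hl]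
      · simp
      · simp [hl.not_gt, hl.ne', not_lt.2 (Fin.le_def.1 hl.le)]
    simp only [h2, Finset.sum_add_distrib, Finset.sum_ite_eq', Finset.mem_univ, if_true]
    rw [Fin.sum_univ_eq_sum_range (fun l => if l < (i : ℕ) then f i l * D l j else 0) (k + 1),
      ← Finset.sum_filter]
    have h3 : Finset.filter (fun l => l < (i : ℕ)) (Finset.range (k + 1)) = Finset.range i := by
      ext l; simp only [Finset.mem_filter, Finset.mem_range]; omega
    rw [h3]
    simp only [Pi.add_apply, Pi.smul_apply, Finset.sum_apply, smul_eq_mul, hD, Fin.val_eq_zero_iff]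
  have hT : T.det = h ^ k := by
    rw [det_of_isLowerTriangular]
    · simp [T, Fin.prod_univ_succ]
    · intro i l hil
      have : i < l := hil
      simp [T, this.not_gt, this.ne']
  rw [hW, det_mul, hT]
  exact dvd_mul_right _ _

end Wronskian

/-! ### The degree count -/

section DegreeBound

open Polynomial

variable {K : Type*} [Field K]

/-- A finite-dimensional space of polynomials has a basis with increasing degrees. -/
lemma exists_strictMono_natDegree (N : ℕ) : ∀ (m : ℕ) (A : Submodule K K[X]),
    A ≤ degreeLT K N → Module.finrank K A = m →
    ∃ b : Fin m → K[X], (∀ i, b i ∈ A ∧ b i ≠ 0) ∧ StrictMono (fun i => (b i).natDegree) ∧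
      ∀ p ∈ A, p ≠ 0 → ∃ i, p.natDegree = (b i).natDegree := by
  induction N with
  | zero =>
    intro m A hA hm
    have hA0 : A = ⊥ := by
      rw [eq_bot_iff]
      intro p hp
      have := mem_degreeLT.1 (hA hp)
      simpa [degree_eq_bot] using this
    subst hA0
    obtain rfl : 0 = m := by simpa using hm
    exact ⟨fun _ => 0, fun i => i.elim0, fun i => i.elim0, fun p hp h0 => absurd hp h0⟩
  | succ N ih =>
    intro m A hA hm
    have hlt : ∀ p ∈ A, p.coeff N = 0 → p ∈ degreeLT K N := by
      intro p hp h0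
      rw [mem_degreeLT, degree_lt_iff_coeff_zero]
      intro k hk
      rcases hk.eq_or_lt with rfl | hk
      · exact h0
      · exact (degree_lt_iff_coeff_zero p (N + 1)).1 (mem_degreeLT.1 (hA hp)) k hk
    -- Either the coefficient of X^N vanishes on A, or its kernel has codimension one and a single
    -- element of degree N completes the basis of the kernel.
    by_cases hall : ∀ p ∈ A, p.coeff N = 0
    · exact ih m A (fun p hp => hlt p hp (hall p hp)) hm
    push Not at hall
    obtain ⟨q, hqA, hq⟩ := hall
    let φ : A →ₗ[K] K := lcoeff K N ∘ₗ A.subtype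
    have hφ : Function.Surjective φ := by
      intro s
      refine ⟨(s / q.coeff N) • ⟨q, hqA⟩, ?_⟩
      simp [φ, hq]
    set A' := (LinearMap.ker φ).map A.subtype with hA'
    have hA'A : ∀ {p}, p ∈ A' ↔ p ∈ A ∧ p.coeff N = 0 := by
      intro p
      simp [hA', φ, Submodule.mem_map, and_comm]
    have : FiniteDimensional K A := Submodule.finiteDimensional_of_le hA
    obtain ⟨m, rfl⟩ : ∃ m', m = m' + 1 := by
      refine ⟨m - 1, ?_⟩
      have : 0 < m := hm ▸ Module.finrank_pos_iff_exists_ne_zero.2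
        ⟨⟨q, hqA⟩, fun h => hq (by simp [(Submodule.mk_eq_zero _ _).1 h])⟩
      omega
    have hm' : Module.finrank K A' = m := by
      rw [hA', Submodule.finrank_map_subtype_eq]
      have := LinearMap.finrank_range_add_finrank_ker φ
      rw [LinearMap.range_eq_top.2 hφ, finrank_top, Module.finrank_self, hm] at this
      omega
    have hA'N : A' ≤ degreeLT K N := fun p hp => hlt p (hA'A.1 hp).1 (hA'A.1 hp).2
    obtain ⟨b, hb, hmono, hex⟩ := ih m A' hA'N hm'
    have hdegN : ∀ p ∈ A, p.coeff N ≠ 0 → p.natDegree = N := fun p hp h0 =>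
      le_antisymm (Nat.lt_succ_iff.1 ((natDegree_lt_iff_degree_lt (fun h => h0 (by simp [h]))).2
        (mem_degreeLT.1 (hA hp)))) (le_natDegree_of_ne_zero h0)
    refine ⟨Fin.snoc b q, ?_, ?_, ?_⟩
    · intro i
      refine Fin.lastCases ?_ (fun i => ?_) i
      · rw [Fin.snoc_last]; exact ⟨hqA, fun h => hq (by simp [h])⟩
      · rw [Fin.snoc_castSucc]; exact ⟨(hA'A.1 (hb i).1).1, (hb i).2⟩
    · intro i j
      refine Fin.lastCases ?_ (fun j => ?_) j <;> refine Fin.lastCases ?_ (fun i => ?_) i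
      · intro h; exact absurd h (lt_irrefl _)
      · intro _
        simp only [Fin.snoc_last, Fin.snoc_castSucc]
        rw [hdegN q hqA hq]
        exact (natDegree_lt_iff_degree_lt (hb i).2).2 (mem_degreeLT.1 (hA'N (hb i).1))
      · intro h; exact absurd h (not_lt.2 (Fin.le_last _))
      · intro h
        simp only [Fin.snoc_castSucc]
        exact hmono (Fin.castSucc_lt_castSucc_iff.1 h)
    · intro p hp h0
      by_cases hpN : p.coeff N = 0
      · obtain ⟨i, hi⟩ := hex p (hA'A.2 ⟨hp, hpN⟩) h0
        exact ⟨i.castSucc, by rw [Fin.snoc_castSucc, hi]⟩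
      · exact ⟨Fin.last m, by rw [Fin.snoc_last, hdegN p hp hpN, hdegN q hqA hq]⟩

/-- The leading terms cannot cancel: their difference carries the factor deg q − deg p, nonzero in
characteristic zero. -/
lemma natDegree_add_le_of_wronskian [CharZero K] {p q : K[X]} (hp : p ≠ 0) (hq : q ≠ 0)
    (hpq : p.natDegree < q.natDegree) :
    p.natDegree + q.natDegree ≤ (p * derivative q - derivative p * q).natDegree + 1 := by
  have h1 : (X * (p * derivative q - derivative p * q)).coeff (p.natDegree + q.natDegree) ≠ 0 := by
    have e : X * (p * derivative q - derivative p * q) =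
        p * (X ^ 1 * derivative^[1] q) - (X ^ 1 * derivative^[1] p) * q := by simp; ring
    rw [e, coeff_sub, coeff_mul_add_eq_of_natDegree_le le_rfl
      (natDegree_X_pow_mul_iterate_derivative_le _ _), coeff_mul_add_eq_of_natDegree_le
      (natDegree_X_pow_mul_iterate_derivative_le _ _) le_rfl,
      coeff_X_pow_mul_iterate_derivative, coeff_X_pow_mul_iterate_derivative]
    have e2 : p.coeff p.natDegree * (((q.natDegree.descFactorial 1 : ℕ) : K) *
        q.coeff q.natDegree) - ((p.natDegree.descFactorial 1 : ℕ) : K) * p.coeff p.natDegree *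
        q.coeff q.natDegree = p.leadingCoeff * q.leadingCoeff *
          (((q.natDegree - p.natDegree : ℕ)) : K) := by
      rw [Nat.cast_sub hpq.le]; simp only [Nat.descFactorial_one, leadingCoeff]; ring
    rw [e2]
    refine mul_ne_zero (mul_ne_zero (leadingCoeff_ne_zero.2 hp) (leadingCoeff_ne_zero.2 hq)) ?_
    exact Nat.cast_ne_zero.2 (by omega)
  refine (le_natDegree_of_ne_zero h1).trans ((natDegree_mul_le).trans ?_)
  rw [natDegree_X, add_comm]

/-- Over the projective line the ramification of a nondegenerate curve in `𝐏ᵏ⁺¹`, whose tangent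
lines form a curve of degree at most `2 k`, vanishes, and the curve has degree `k + 1`. -/
theorem natDegree_le_of_tangent_degree [CharZero K] {k : ℕ} (hk : 0 < k)
    {a b : Fin (k + 2) → K[X]} {r h : K[X]} (ha : LinearIndependent K a)
    (hM : ∀ i j, (wedgeMatrix a b i j).natDegree ≤ 2 * k)
    (hab : derivVec a = r • a + h • b) :
    h.natDegree = 0 ∧ ∀ i, (a i).natDegree ≤ k + 1 := by
  set A := Submodule.span K (Set.range a) with hA
  have hrank : Module.finrank K A = k + 2 := by
    rw [hA, finrank_span_eq_card ha, Fintype.card_fin]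
  obtain ⟨N, hN⟩ : ∃ N, A ≤ degreeLT K N := by
    refine ⟨Finset.univ.sup (fun i => (a i).natDegree) + 1, ?_⟩
    rw [hA, Submodule.span_le]
    rintro _ ⟨i, rfl⟩
    rw [SetLike.mem_coe, mem_degreeLT]
    refine degree_le_natDegree.trans_lt ?_
    exact_mod_cast Nat.lt_succ_of_le (Finset.le_sup (f := fun i => (a i).natDegree)
      (Finset.mem_univ i))
  -- A linear change of coordinates in the target makes the degrees distinct. Applied to b as well,
  -- it preserves the differential relation and the bound 2k.
  obtain ⟨p, hpA, hmono, hex⟩ := exists_strictMono_natDegree N _ A hN hrank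
  have hcomb : ∀ i, ∃ P : Fin (k + 2) → K, ∑ j, P j • a j = p i := fun i =>
    (Submodule.mem_span_range_iff_exists_fun K).1 (hpA i).1
  choose P hP using hcomb
  set q : Fin (k + 2) → K[X] := fun i => ∑ j, P i j • b j with hq
  have hpq : derivVec p = r • p + h • q := by
    ext1 i
    have h1 : ∀ j, derivative (a j) = r * a j + h * b j := fun j => congrFun hab j
    simp only [derivVec, ← hP, derivative_sum, derivative_smul, h1, Pi.add_apply, Pi.smul_apply,
      smul_eq_mul, hq, Finset.mul_sum, smul_add, Finset.sum_add_distrib, mul_smul_comm]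
  have hdeg : ∀ i j, (wedgeMatrix p q i j).natDegree ≤ 2 * k := by
    intro i j
    have e : wedgeMatrix p q i j = ∑ s, ∑ t, (P i s * P j t) • wedgeMatrix a b s t := by
      simp only [wedgeMatrix_apply, ← hP, hq, Finset.sum_mul_sum, ← Finset.sum_sub_distrib,
        smul_mul_smul_comm, smul_sub]
    rw [e]
    exact natDegree_sum_le_of_forall_le _ _ fun s _ => natDegree_sum_le_of_forall_le _ _
      fun t _ => (natDegree_smul_le _ _).trans (hM s t)
  obtain ⟨hW0, hWdeg⟩ := wronskianMatrix_det_ne_zero (fun i => (hpA i).2) hmono.injective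
  have hdvd := natDegree_le_of_dvd (pow_dvd_det_wronskianMatrix hpq) hW0
  rw [natDegree_pow] at hdvd
  set e : Fin (k + 2) → ℕ := fun i => (p i).natDegree with he
  set E := e (Fin.last (k + 1)) with hE
  set E' := e (Fin.last k).castSucc with hE'
  -- The two-by-two Wronskian of the top two coordinates is h times an entry of p ∧ q.
  have hlow : E' + E ≤ h.natDegree + 2 * k + 1 := by
    have h1 := natDegree_add_le_of_wronskian (hpA (Fin.last k).castSucc).2
      (hpA (Fin.last (k + 1))).2 (hmono (Fin.castSucc_lt_last _))
    have h2 : p (Fin.last k).castSucc * derivative (p (Fin.last (k + 1))) -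
        derivative (p (Fin.last k).castSucc) * p (Fin.last (k + 1)) =
        h * wedgeMatrix p q (Fin.last k).castSucc (Fin.last (k + 1)) := by
      have h3 : ∀ j, derivative (p j) = r * p j + h * q j := fun j => congrFun hpq j
      rw [h3, h3, wedgeMatrix_apply]; ring
    rw [h2] at h1
    have h4 := (natDegree_mul_le (p := h)
      (q := wedgeMatrix p q (Fin.last k).castSucc (Fin.last (k + 1)))).trans
      (Nat.add_le_add_left (hdeg _ _) _)
    change E' + E ≤ _ at h1
    omega
  have hgap : ∀ i j : Fin (k + 2), i ≤ j → e i + (j - i : ℕ) ≤ e j := by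
    intro i j
    induction j using Fin.induction with
    | zero => intro hij; simp [Fin.le_zero_iff.1 hij]
    | succ j ih =>
      intro hij
      rcases hij.eq_or_lt with rfl | hij
      · simp
      · have hij' : i ≤ j.castSucc := Fin.le_castSucc_iff.2 hij
        have h1 := ih hij'
        have h2 := hmono (Fin.castSucc_lt_succ (i := j))
        have h3 : (i : ℕ) ≤ j := hij'
        simp only [Fin.val_castSucc, Fin.val_succ] at h1 ⊢
        change e j.castSucc < e j.succ at h2
        omega
  -- Distinct degrees give e i ≤ E' − (k − i) for i ≤ k. The second inequality ensures that the
  -- subtraction does not truncate.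
  have hsum : ∑ i, e i ≤ E + ((k + 1) * E' - ∑ i ∈ Finset.range (k + 1), i) ∧
      ∑ i ∈ Finset.range (k + 1), i ≤ (k + 1) * E' := by
    have h1 : ∀ i : Fin (k + 1), e i.castSucc + (k - i : ℕ) ≤ E' := fun i => by
      simpa using hgap i.castSucc (Fin.last k).castSucc
        (Fin.castSucc_le_castSucc_iff.2 (Fin.le_last _))
    have h2 : ∑ i : Fin (k + 1), (e i.castSucc + (k - i : ℕ)) ≤ (k + 1) * E' := by
      refine (Finset.sum_le_sum fun i _ => h1 i).trans ?_
      simp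
    rw [Finset.sum_add_distrib, Fin.sum_univ_eq_sum_range (fun i => k - i)] at h2
    have h3 : ∑ i ∈ Finset.range (k + 1), (k - i) = ∑ i ∈ Finset.range (k + 1), i := by
      rw [← Finset.sum_range_reflect]
      exact Finset.sum_congr rfl fun i hi => by have := Finset.mem_range.1 hi; omega
    rw [h3] at h2
    rw [Fin.sum_univ_castSucc]
    omega
  have hgauss := Finset.sum_range_id_mul_two (k + 1)
  rw [Nat.add_sub_cancel] at hgauss
  rw [Fin.sum_univ_eq_sum_range (fun i => i), Finset.sum_range_succ] at hWdeg
  have hmain : (k + 1) * h.natDegree + (k + 1) * (k + 1) ≤ E + (k + 1) * E' := by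
    change _ ≤ ∑ i, e i at hWdeg
    have e1 : (k + 1) * (k + 1) = (k + 1) * k + (k + 1) := by ring
    omega
  -- Adding k + 1 times `hlow` to `hmain` cancels both deg h and E', leaving k E ≤ k (k + 1).
  have hEle : E ≤ k + 1 := by
    have h1 : (k + 1) * (E' + E) ≤ (k + 1) * (h.natDegree + 2 * k + 1) :=
      Nat.mul_le_mul_left _ hlow
    have h2 : k * E ≤ k * (k + 1) := by nlinarith
    exact Nat.le_of_mul_le_mul_left h2 hk
  constructor
  -- Distinct degrees of at most k + 1 satisfy e i ≤ i, which leaves no room for deg h in the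
  -- Wronskian bound.
  · have h1 : ∑ i, e i ≤ ∑ i : Fin (k + 2), (i : ℕ) := Finset.sum_le_sum fun i _ => by
      have := hgap i (Fin.last _) (Fin.le_last _)
      rw [← hE, Fin.val_last] at this
      have := i.2
      omega
    rw [Fin.sum_univ_eq_sum_range (fun i => i), Finset.sum_range_succ] at h1
    change _ ≤ ∑ i, e i at hWdeg
    have h2 : (k + 1) * h.natDegree ≤ 0 := by omega
    simpa using h2
  · intro i
    by_cases h0 : a i = 0
    · simp [h0]
    · obtain ⟨j, hj⟩ := hex (a i) (Submodule.subset_span ⟨i, rfl⟩) h0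
      rw [hj]
      exact (hmono.monotone (Fin.le_last j)).trans hEle

end DegreeBound

/-! ### Plücker coordinates -/

lemma update_pair_zero {V : Type*} (x y z : V) : Function.update ![x, y] 0 z = ![z, y] := by
  ext i; fin_cases i <;> rfl

lemma update_pair_one {V : Type*} (x y z : V) : Function.update ![x, y] 1 z = ![x, z] := by
  ext i; fin_cases i <;> rfl

section Plucker

variable {V : Type*} [AddCommGroup V] [Module ℂ V]

/-- The wedge product of two vectors as a bilinear map to the second exterior power. -/
noncomputable def wedgeBilin (V : Type*) [AddCommGroup V] [Module ℂ V] :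
    V →ₗ[ℂ] V →ₗ[ℂ] ⋀[ℂ]^2 V :=
  LinearMap.mk₂ ℂ (fun x y => exteriorPower.ιMulti ℂ 2 ![x, y])
    (fun x x' y => by
      have := (exteriorPower.ιMulti ℂ 2 (M := V)).map_update_add ![0, y] 0 x x'
      simpa only [update_pair_zero, update_pair_one] using this)
    (fun s x y => by
      have := (exteriorPower.ιMulti ℂ 2 (M := V)).map_update_smul ![0, y] 0 s x
      simpa only [update_pair_zero, update_pair_one] using this)
    (fun x y y' => by
      have := (exteriorPower.ιMulti ℂ 2 (M := V)).map_update_add ![x, 0] 1 y y'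
      simpa only [update_pair_zero, update_pair_one] using this)
    (fun s x y => by
      have := (exteriorPower.ιMulti ℂ 2 (M := V)).map_update_smul ![x, 0] 1 s y
      simpa only [update_pair_zero, update_pair_one] using this)

lemma wedgeBilin_apply (x y : V) : wedgeBilin V x y = exteriorPower.ιMulti ℂ 2 ![x, y] := rfl

lemma wedgeBilin_self (x : V) : wedgeBilin V x x = 0 :=
  (exteriorPower.ιMulti ℂ 2 (M := V)).map_eq_zero_of_eq ![x, x] (i := 0) (j := 1) rfl (by simp)

lemma wedgeBilin_swap (x y : V) : wedgeBilin V y x = -wedgeBilin V x y := by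
  have h := wedgeBilin_self (x + y)
  simp only [map_add, LinearMap.add_apply, wedgeBilin_self, zero_add, add_zero] at h
  exact eq_neg_of_add_eq_zero_left h

lemma ιMulti_eq_wedgeBilin (v : Fin 2 → V) :
    exteriorPower.ιMulti ℂ 2 v = wedgeBilin V (v 0) (v 1) := by
  rw [wedgeBilin_apply]
  congr 1
  ext i; fin_cases i <;> rfl

lemma map_wedgeBilin {V' : Type*} [AddCommGroup V'] [Module ℂ V'] (f : V →ₗ[ℂ] V') (x y : V) :
    exteriorPower.map 2 f (wedgeBilin V x y) = wedgeBilin V' (f x) (f y) := by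
  rw [wedgeBilin_apply, exteriorPower.map_apply_ιMulti, ιMulti_eq_wedgeBilin]
  rfl

variable {m : ℕ}

/-- The skew-symmetric matrix of a bivector. -/
noncomputable def bivectorMatrix (m : ℕ) : ⋀[ℂ]^2 (Fin m → ℂ) →ₗ[ℂ] Matrix (Fin m) (Fin m) ℂ :=
  exteriorPower.alternatingMapLinearEquiv
    { toFun := fun v => wedgeMatrix (v 0) (v 1)
      map_update_add' := fun v i x y => by
        ext k l
        fin_cases i <;> simp [wedgeMatrix_apply] <;> ring
      map_update_smul' := fun v i s x => by
        ext k l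
        fin_cases i <;> simp [wedgeMatrix_apply] <;> ring
      map_eq_zero_of_eq' := fun v i j hij hne => by
        ext k l
        fin_cases i <;> fin_cases j <;> simp_all [wedgeMatrix_apply] }

lemma bivectorMatrix_wedgeBilin (x y : Fin m → ℂ) :
    bivectorMatrix m (wedgeBilin _ x y) = wedgeMatrix x y := by
  rw [wedgeBilin_apply, bivectorMatrix, exteriorPower.alternatingMapLinearEquiv_apply_ιMulti]
  rfl

lemma wedgeBilin_eq_sum (x y : Fin m → ℂ) : wedgeBilin _ x y =
    ∑ i, ∑ j, (x i * y j) • wedgeBilin _ (Pi.single i 1 : Fin m → ℂ) (Pi.single j 1) := by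
  conv_lhs => rw [pi_eq_sum_univ' x, pi_eq_sum_univ' y]
  simp only [map_sum, map_smul, LinearMap.sum_apply, LinearMap.smul_apply, Finset.smul_sum,
    smul_smul]
  rw [Finset.sum_comm]
  simp only [mul_comm]

/-- Ψ is a left inverse up to the factor 2: each pair of basis vectors is counted in both orders. -/
lemma bivectorMatrix_injective : Function.Injective (bivectorMatrix m) := by
  let Ψ : Matrix (Fin m) (Fin m) ℂ →ₗ[ℂ] ⋀[ℂ]^2 (Fin m → ℂ) :=
    ∑ i, ∑ j, (Matrix.entryLinearMap ℂ ℂ i j).smulRight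
      (wedgeBilin _ (Pi.single i 1 : Fin m → ℂ) (Pi.single j 1))
  have h : Ψ ∘ₗ bivectorMatrix m = (2 : ℂ) • LinearMap.id := by
    apply exteriorPower.linearMap_ext
    ext v : 1
    simp only [LinearMap.compAlternatingMap_apply, LinearMap.comp_apply, LinearMap.smul_apply,
      LinearMap.id_apply]
    rw [ιMulti_eq_wedgeBilin, bivectorMatrix_wedgeBilin]
    simp only [Ψ, LinearMap.sum_apply, LinearMap.smulRight_apply, Matrix.entryLinearMap_apply,
      wedgeMatrix_apply, sub_smul, Finset.sum_sub_distrib]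
    simp only [mul_comm (v 1 _)]
    have e := wedgeBilin_eq_sum (v 1) (v 0)
    simp only [mul_comm (v 1 _)] at e
    rw [← wedgeBilin_eq_sum, ← e, wedgeBilin_swap (v 0) (v 1), two_smul, sub_neg_eq_add]
  intro x y hxy
  have h1 := LinearMap.congr_fun h x
  have h2 := LinearMap.congr_fun h y
  simp only [LinearMap.comp_apply, hxy] at h1 h2
  rw [h1] at h2
  simpa using h2

lemma exists_bivectorMatrix_eq_wedgeMatrix {x : ℙ ℂ (⋀[ℂ]^2 (Fin m → ℂ))}
    (hx : x ∈ grassmannianOfLines (Fin m → ℂ)) {w : ⋀[ℂ]^2 (Fin m → ℂ)} (hw : w ∈ x.submodule) :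
    ∃ a b, bivectorMatrix m w = wedgeMatrix a b := by
  obtain ⟨ℓ, a, b, -, -, h⟩ := hx
  rw [h, Submodule.mem_span_singleton] at hw
  obtain ⟨s, rfl⟩ := hw
  refine ⟨s • a, b, ?_⟩
  rw [← wedgeBilin_apply, ← bivectorMatrix_wedgeBilin, map_smul (wedgeBilin _),
    LinearMap.smul_apply]

/-- A line is recovered from its Plücker point as the image of the skew-symmetric matrix. -/
lemma IsPluckerPoint.eq_range {ℓ : Submodule ℂ (Fin m → ℂ)} {x : ℙ ℂ (⋀[ℂ]^2 (Fin m → ℂ))}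
    (h : IsPluckerPoint ℓ x) {w : ⋀[ℂ]^2 (Fin m → ℂ)} (hw : x.submodule = Submodule.span ℂ {w}) :
    ℓ = LinearMap.range (bivectorMatrix m w).mulVecLin := by
  obtain ⟨a, b, hab, rfl, hx⟩ := h
  have hw0 : w ≠ 0 := by
    rintro rfl
    have := x.finrank_submodule
    rw [hw, Submodule.span_zero_singleton, finrank_bot] at this
    exact zero_ne_one this
  have hmem : w ∈ Submodule.span ℂ {exteriorPower.ιMulti ℂ 2 ![a, b]} := by
    rw [← hx, hw]; exact Submodule.mem_span_singleton_self w
  obtain ⟨s, rfl⟩ := Submodule.mem_span_singleton.1 hmem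
  have hs : s ≠ 0 := by rintro rfl; simp at hw0
  rw [map_smul, ← wedgeBilin_apply, bivectorMatrix_wedgeBilin, ← range_mulVecLin_wedgeMatrix hab]
  have e : (s • wedgeMatrix a b).mulVecLin = s • (wedgeMatrix a b).mulVecLin := by
    ext1 v; simp
  rw [e, LinearMap.range_smul _ _ hs]

end Plucker

/-! ### Rational normal curves and their tangent lines -/

namespace RationalNormalCurve

variable {V : Type*} [AddCommGroup V] [Module ℂ V] {d : ℕ}

lemma vec_eq (C : RationalNormalCurve d V) (p : Fin 2 → ℂ) :
    C.vec p = C.embed fun i => p 0 ^ (d - (i : ℕ)) * p 1 ^ (i : ℕ) := by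
  simp [vec, veroneseForm]

lemma partialVec_zero_eq (C : RationalNormalCurve d V) (p : Fin 2 → ℂ) :
    C.partialVec 0 p = C.embed fun i =>
      ((d - (i : ℕ) : ℕ) : ℂ) * p 0 ^ (d - (i : ℕ) - 1) * p 1 ^ (i : ℕ) := by
  unfold partialVec
  congr 1
  ext i
  simp [veroneseForm, Derivation.leibniz, MvPolynomial.pderiv_X, Derivation.leibniz_pow]
  ring

lemma partialVec_one_eq (C : RationalNormalCurve d V) (p : Fin 2 → ℂ) :
    C.partialVec 1 p = C.embed fun i =>
      ((i : ℕ) : ℂ) * p 0 ^ (d - (i : ℕ)) * p 1 ^ ((i : ℕ) - 1) := by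
  unfold partialVec
  congr 1
  ext i
  simp [veroneseForm, Derivation.leibniz, MvPolynomial.pderiv_X, Derivation.leibniz_pow]
  ring

lemma vec_ne_zero (C : RationalNormalCurve d V) {p : Fin 2 → ℂ} (hp : p ≠ 0) : C.vec p ≠ 0 := by
  rw [vec_eq, Ne, ← map_zero C.embed, C.embed_injective.eq_iff]
  intro h
  apply hp
  ext j
  fin_cases j
  · have := congrFun h 0
    simp at this
    exact this.1
  · have := congrFun h (Fin.last d)
    simp at this
    exact this.1

/-- Euler's formula. -/
lemma smul_vec_eq (C : RationalNormalCurve d V) (p : Fin 2 → ℂ) :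
    (d : ℂ) • C.vec p = p 0 • C.partialVec 0 p + p 1 • C.partialVec 1 p := by
  rw [vec_eq, partialVec_zero_eq, partialVec_one_eq, ← map_smul, ← map_smul, ← map_smul, ← map_add]
  congr 1
  ext i
  simp only [Pi.smul_apply, Pi.add_apply, smul_eq_mul]
  obtain ⟨n, hn⟩ := Nat.exists_eq_add_of_le (Nat.lt_succ_iff.1 i.2)
  have hn' : d - (i : ℕ) = n := by omega
  rw [hn']
  have h1 : (d : ℂ) = (i : ℕ) + n := by rw [← Nat.cast_add, ← hn]
  have h2 : ∀ (k : ℕ) (z : ℂ), z * (k * z ^ (k - 1)) = k * z ^ k := by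
    intro k z
    rcases k with _ | k
    · simp
    · rw [Nat.add_sub_cancel, pow_succ]; ring
  rw [h1]
  linear_combination (-(p 1) ^ (i : ℕ)) * h2 n (p 0) - (p 0) ^ n * h2 i (p 1)

lemma partialVec_smul (C : RationalNormalCurve d V) (j : Fin 2) (s : ℂ) (p : Fin 2 → ℂ) :
    C.partialVec j (s • p) = s ^ (d - 1) • C.partialVec j p := by
  fin_cases j
  · simp only [Fin.zero_eta, Fin.isValue, partialVec_zero_eq]
    rw [← map_smul]
    congr 1
    ext i
    simp only [Pi.smul_apply, smul_eq_mul, mul_pow]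
    by_cases hi : d - (i : ℕ) = 0
    · simp [hi]
    · have : d - 1 = (d - (i : ℕ) - 1) + i := by omega
      rw [this, pow_add]; ring
  · simp only [Fin.mk_one, Fin.isValue, partialVec_one_eq]
    rw [← map_smul]
    congr 1
    ext i
    simp only [Pi.smul_apply, smul_eq_mul, mul_pow]
    by_cases hi : (i : ℕ) = 0
    · simp [hi]
    · have : d - 1 = (d - (i : ℕ)) + (i - 1) := by have := i.2; omega
      rw [this, pow_add]; ring

lemma vec_smul (C : RationalNormalCurve d V) (s : ℂ) (p : Fin 2 → ℂ) :
    C.vec (s • p) = s ^ d • C.vec p := by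
  rw [vec_eq, vec_eq, ← map_smul]
  congr 1
  ext i
  simp only [Pi.smul_apply, smul_eq_mul, mul_pow]
  have : s ^ d = s ^ (d - (i : ℕ)) * s ^ (i : ℕ) := by
    rw [← pow_add]; congr 1; have := i.2; omega
  rw [this]
  ring

/-- The affine points of a rational normal curve span the same space as the curve. -/
lemma range_embed_le (C : RationalNormalCurve d V) {L : Submodule ℂ V}
    (h : ∀ t : ℂ, C.vec ![1, t] ∈ L) : LinearMap.range C.embed ≤ L := by
  rw [LinearMap.range_le_iff_comap]
  by_contra hne
  obtain ⟨φ, hφ, hle⟩ := Submodule.exists_le_ker_of_lt_top _ (lt_top_iff_ne_top.2 hne)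
  apply hφ
  have hφe : ∀ x : Fin (d + 1) → ℂ, φ x = ∑ i, x i * φ (Pi.single i 1) := fun x => by
    conv_lhs => rw [pi_eq_sum_univ' x]
    simp
  -- Along the curve φ is a polynomial in t whose coefficients are its values on the standard basis.
  have hpoly : (∑ i : Fin (d + 1), Polynomial.C (φ (Pi.single i 1)) * Polynomial.X ^ (i : ℕ)) =
      0 := by
    apply Polynomial.funext
    intro t
    have h1 : (fun i : Fin (d + 1) => t ^ (i : ℕ)) ∈ L.comap C.embed := by
      have := h t
      rw [vec_eq] at this
      simpa using this
    have h2 : φ _ = 0 := hle h1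
    rw [hφe] at h2
    rw [Polynomial.eval_finsetSum, Polynomial.eval_zero, ← h2]
    exact Finset.sum_congr rfl fun i _ => by
      rw [Polynomial.eval_mul, Polynomial.eval_C, Polynomial.eval_pow, Polynomial.eval_X, mul_comm]
  ext i
  have := congrArg (fun p => p.coeff (i : ℕ)) hpoly
  simp only [Polynomial.finsetSum_coeff, Polynomial.coeff_C_mul, Polynomial.coeff_X_pow,
    Fin.val_inj, mul_ite, mul_one, mul_zero, Finset.sum_ite_eq, Finset.mem_univ, if_true,
    Polynomial.coeff_zero] at this
  simpa using this

variable {m D : ℕ}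

/-- If the Plücker coordinates of the tangent lines of `Z` are those of the points of `C`, the
lines parametrized by `C` are the tangent lines of `Z`. -/
lemma linesOf_points_eq (C : RationalNormalCurve d (⋀[ℂ]^2 (Fin m → ℂ)))
    (Z : RationalNormalCurve D (Fin m → ℂ)) {κ : ℂ} (hκ : κ ≠ 0)
    (h : ∀ p, wedgeMatrix (Z.partialVec 0 p) (Z.partialVec 1 p) = κ • bivectorMatrix m (C.vec p)) :
    linesOf C.points = Z.tangentLines := by
  have h' : ∀ p, wedgeBilin _ (Z.partialVec 0 p) (Z.partialVec 1 p) = κ • C.vec p := fun p =>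
    bivectorMatrix_injective (by rw [bivectorMatrix_wedgeBilin, h, map_smul])
  have hmem : ∀ (p : Fin 2 → ℂ) (hp : p ≠ 0), IsPluckerPoint (Z.tangentLine p)
      (Projectivization.mk ℂ (C.vec p) (C.vec_ne_zero hp)) := by
    intro p hp
    refine ⟨_, _, ?_, rfl, ?_⟩
    · apply linearIndependent_of_wedgeMatrix_ne_zero
      rw [h]
      exact smul_ne_zero hκ fun h0 =>
        C.vec_ne_zero hp (bivectorMatrix_injective (by rw [h0, map_zero]))
    · rw [← wedgeBilin_apply, h', Projectivization.submodule_mk,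
        Submodule.span_singleton_smul_eq hκ.isUnit]
  ext ℓ
  constructor
  · rintro ⟨x, ⟨p, hp, hx⟩, hℓ⟩
    refine ⟨p, hp, ?_⟩
    rw [hℓ.eq_range hx, (hmem p hp).eq_range (Projectivization.submodule_mk _ _)]
  · rintro ⟨p, hp, rfl⟩
    exact ⟨_, ⟨p, hp, Projectivization.submodule_mk _ _⟩, hmem p hp⟩

lemma sweptOut_points_eq {C : RationalNormalCurve d (⋀[ℂ]^2 (Fin m → ℂ))}
    {Z : RationalNormalCurve D (Fin m → ℂ)} (h : linesOf C.points = Z.tangentLines) :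
    sweptOut C.points = Z.tangentScroll := by
  rw [sweptOut, h, tangentScroll]

end RationalNormalCurve

/-! ### From the tangent scroll to the dichotomy -/

namespace RationalNormalCurve

variable {V : Type*} [AddCommGroup V] [Module ℂ V] {d m : ℕ}

lemma apply_eq_sum_single {n : ℕ} {W : Type*} [AddCommGroup W] [Module ℂ W]
    (T : (Fin n → ℂ) →ₗ[ℂ] W) (x : Fin n → ℂ) : T x = ∑ k, x k • T (Pi.single k 1) := by
  conv_lhs => rw [pi_eq_sum_univ' x]
  simp

open Polynomial in
lemma polyMatrix_eval_eq (C : RationalNormalCurve d (⋀[ℂ]^2 (Fin m → ℂ))) (t : ℂ) :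
    (polyMatrix fun k => bivectorMatrix m (C.embed (Pi.single k 1))).map (eval t) =
      bivectorMatrix m (C.vec ![1, t]) := by
  rw [vec_eq, apply_eq_sum_single C.embed]
  ext i j
  simp [polyMatrix_apply, eval_finsetSum, Matrix.sum_apply]
  exact Finset.sum_congr rfl fun k _ => mul_comm _ _

open Polynomial in
lemma polyMatrix_eval_derivative_eq (C : RationalNormalCurve d (⋀[ℂ]^2 (Fin m → ℂ))) (t : ℂ) :
    (polyMatrix fun k => bivectorMatrix m (C.embed (Pi.single k 1))).map
      (fun p => eval t (derivative p)) = bivectorMatrix m (C.partialVec 1 ![1, t]) := by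
  rw [partialVec_one_eq, apply_eq_sum_single C.embed]
  ext i j
  simp [polyMatrix_apply, eval_finsetSum, Matrix.sum_apply, derivative_X_pow]
  exact Finset.sum_congr rfl fun k _ => by ring

lemma linearIndependent_bivectorMatrix (C : RationalNormalCurve d (⋀[ℂ]^2 (Fin m → ℂ))) :
    LinearIndependent ℂ fun k => bivectorMatrix m (C.embed (Pi.single k 1)) := by
  have h1 : LinearIndependent ℂ fun k : Fin (d + 1) => (Pi.single k 1 : Fin (d + 1) → ℂ) := by
    convert (Pi.basisFun ℂ (Fin (d + 1))).linearIndependent using 1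
    ext k : 1
    simp
  have h2 := h1.map' (bivectorMatrix m ∘ₗ C.embed) (LinearMap.ker_eq_bot.2
    (bivectorMatrix_injective.comp C.embed_injective))
  exact h2

/-- By Euler's formula, with d ≠ 0, the tangent line contains the point itself besides the affine
derivative, so every nonzero combination of the two represents a point of the scroll. -/
lemma exists_wedgeMatrix_of_tangentScroll (hd : d ≠ 0)
    (C : RationalNormalCurve d (⋀[ℂ]^2 (Fin m → ℂ)))
    (hC : C.tangentScroll ⊆ grassmannianOfLines (Fin m → ℂ)) (α β t : ℂ) :
    ∃ x y, α • bivectorMatrix m (C.vec ![1, t]) +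
      β • bivectorMatrix m (C.partialVec 1 ![1, t]) = wedgeMatrix x y := by
  set w := α • C.vec ![1, t] + β • C.partialVec 1 ![1, t] with hw
  have e : α • bivectorMatrix m (C.vec ![1, t]) +
      β • bivectorMatrix m (C.partialVec 1 ![1, t]) = bivectorMatrix m w := by
    rw [hw, map_add, map_smul, map_smul]
  rw [e]
  by_cases hw0 : w = 0
  · exact ⟨0, 0, by rw [hw0]; ext i j; simp [wedgeMatrix_apply]⟩
  have hmem0 : C.partialVec 0 ![1, t] ∈ C.tangentLine ![1, t] := Submodule.subset_span (by simp)
  have hmem1 : C.partialVec 1 ![1, t] ∈ C.tangentLine ![1, t] := Submodule.subset_span (by simp)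
  have hvec : C.vec ![1, t] ∈ C.tangentLine ![1, t] := by
    have h1 : (d : ℂ) • C.vec ![1, t] ∈ C.tangentLine ![1, t] := by
      rw [smul_vec_eq]
      exact add_mem (Submodule.smul_mem _ _ hmem0) (Submodule.smul_mem _ _ hmem1)
    exact (Submodule.smul_mem_iff _ (Nat.cast_ne_zero.2 hd)).1 h1
  have hwt : w ∈ C.tangentLine ![1, t] :=
    add_mem (Submodule.smul_mem _ _ hvec) (Submodule.smul_mem _ _ hmem1)
  have hG : Projectivization.mk ℂ w hw0 ∈ grassmannianOfLines (Fin m → ℂ) := by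
    apply hC
    refine Set.mem_biUnion (x := C.tangentLine ![1, t]) ⟨![1, t], ?_, rfl⟩ ?_
    · intro h; simpa using congrFun h 0
    · change (Projectivization.mk ℂ w hw0).submodule ≤ _
      rw [Projectivization.submodule_mk, Submodule.span_singleton_le_iff_mem]
      exact hwt
  refine exists_bivectorMatrix_eq_wedgeMatrix hG ?_
  rw [Projectivization.submodule_mk]
  exact Submodule.mem_span_singleton_self w

open Polynomial in
/-- The rational normal curve with the given independent polynomial coordinates. -/
noncomputable def ofPolynomials {k : ℕ} (a : Fin (k + 1) → ℂ[X]) (ha : LinearIndependent ℂ a)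
    (hdeg : ∀ i, (a i).natDegree ≤ k) : RationalNormalCurve k (Fin (k + 1) → ℂ) where
  embed := (Matrix.of fun i j : Fin (k + 1) => (a i).coeff j).mulVecLin
  embed_injective := by
    rw [Matrix.coe_mulVecLin, Matrix.mulVec_injective_iff_isUnit,
      ← Matrix.linearIndependent_rows_iff_isUnit, Fintype.linearIndependent_iff]
    intro g hg
    apply Fintype.linearIndependent_iff.1 ha
    ext n
    rw [finsetSum_coeff]
    by_cases hn : n < k + 1
    · have := congrFun hg ⟨n, hn⟩
      simpa [Matrix.row] using this
    · simp only [coeff_smul, coeff_zero]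
      exact Finset.sum_eq_zero fun i _ => by
        rw [coeff_eq_zero_of_natDegree_lt (by have := hdeg i; omega), smul_zero]

section OfPolynomials

open Polynomial

variable {k : ℕ} {a : Fin (k + 1) → ℂ[X]} (ha : LinearIndependent ℂ a)
  (hdeg : ∀ i, (a i).natDegree ≤ k)

lemma vec_ofPolynomials (t : ℂ) :
    (ofPolynomials a ha hdeg).vec ![1, t] = fun i => (a i).eval t := by
  rw [vec_eq]
  ext i
  rw [eval_eq_sum_range' (Nat.lt_succ_of_le (hdeg i)), ← Fin.sum_univ_eq_sum_range
    (fun n => (a i).coeff n * t ^ n)]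
  simp [ofPolynomials, Matrix.mulVec, dotProduct]

lemma partialVec_one_ofPolynomials (t : ℂ) :
    (ofPolynomials a ha hdeg).partialVec 1 ![1, t] = fun i => (derivative (a i)).eval t := by
  rw [partialVec_one_eq]
  ext i
  rw [derivative_eval, sum_over_range' _ (by simp) (k + 1) (Nat.lt_succ_of_le (hdeg i)),
    ← Fin.sum_univ_eq_sum_range (fun n => (a i).coeff n * n * t ^ (n - 1))]
  simp [ofPolynomials, Matrix.mulVec, dotProduct, mul_assoc]

end OfPolynomials

/-- A proportionality of Plücker coordinates which holds on an affine chart of the parameter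
line holds everywhere. -/
lemma wedgeMatrix_partialVec_eq {k : ℕ} (C : RationalNormalCurve (2 * k) (⋀[ℂ]^2 (Fin m → ℂ)))
    (Z : RationalNormalCurve (k + 1) (Fin m → ℂ)) {κ : ℂ}
    (h : ∀ t, wedgeMatrix (Z.partialVec 0 ![1, t]) (Z.partialVec 1 ![1, t]) =
      κ • bivectorMatrix m (C.vec ![1, t])) (p : Fin 2 → ℂ) :
    wedgeMatrix (Z.partialVec 0 p) (Z.partialVec 1 p) = κ • bivectorMatrix m (C.vec p) := by
  have hne : ∀ s q : ℂ, s ≠ 0 → wedgeMatrix (Z.partialVec 0 ![s, q]) (Z.partialVec 1 ![s, q]) =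
      κ • bivectorMatrix m (C.vec ![s, q]) := by
    intro s q hs
    have e : (![s, q] : Fin 2 → ℂ) = s • ![1, q / s] := by
      ext i; fin_cases i <;> simp [mul_div_cancel₀, hs]
    rw [e, partialVec_smul, partialVec_smul, vec_smul, map_smul, smul_comm, ← h, Nat.add_sub_cancel]
    ext i j
    simp only [wedgeMatrix_apply, Matrix.smul_apply, Pi.smul_apply, smul_eq_mul]
    ring
  have hp : p = ![p 0, p 1] := by ext i; fin_cases i <;> rfl
  rw [hp]
  by_cases hs : p 0 ≠ 0
  · exact hne _ _ hs
  -- The parameter [0 : 1] is out of reach of homogeneity; both sides are continuous in the first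
  -- coordinate and agree on the dense set s ≠ 0.
  have hc : ∀ {n : ℕ} (T : (Fin (n + 1) → ℂ) →ₗ[ℂ] (Fin m → ℂ)), Continuous T := fun T =>
    T.continuous_of_finiteDimensional
  have hcd : ∀ (T : (Fin (2 * k + 1) → ℂ) →ₗ[ℂ] Matrix (Fin m) (Fin m) ℂ), Continuous T := fun T =>
    T.continuous_of_finiteDimensional
  have hV0 : Continuous fun s : ℂ => Z.partialVec 0 ![s, p 1] := by
    simp only [partialVec_zero_eq]
    refine (hc Z.embed).comp (continuous_pi fun i => ?_)
    simp only [cons_val]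
    fun_prop
  have hV1 : Continuous fun s : ℂ => Z.partialVec 1 ![s, p 1] := by
    simp only [partialVec_one_eq]
    refine (hc Z.embed).comp (continuous_pi fun i => ?_)
    simp only [cons_val]
    fun_prop
  have hC : Continuous fun s : ℂ => bivectorMatrix m (C.vec ![s, p 1]) := by
    simp only [vec_eq]
    refine (hcd (bivectorMatrix m ∘ₗ C.embed)).comp (continuous_pi fun i => ?_)
    simp only [cons_val]
    fun_prop
  have hfun : (fun s : ℂ => wedgeMatrix (Z.partialVec 0 ![s, p 1]) (Z.partialVec 1 ![s, p 1])) =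
      fun s => κ • bivectorMatrix m (C.vec ![s, p 1]) := by
    refine Continuous.ext_on (dense_compl_singleton (0 : ℂ)) ?_ (hC.const_smul κ)
      fun s hs => hne s _ hs
    have h0 := continuous_pi_iff.1 hV0
    have h1 := continuous_pi_iff.1 hV1
    exact continuous_matrix fun i j => ((h0 i).mul (h1 j)).sub ((h1 i).mul (h0 j))
  exact congrFun hfun (p 0)

open Polynomial in
/-- A rational normal curve of degree `2 k` in the Grassmannian of lines of `𝐏ᵏ⁺¹` whose tangent
scroll lies in the Grassmannian consists of the tangent lines of a rational normal curve, or
of lines contained in a hyperplane. -/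
theorem tangentLines_or_hyperplane {k : ℕ} (hk : 2 ≤ k)
    (C : RationalNormalCurve (2 * k) (⋀[ℂ]^2 (Fin (k + 2) → ℂ)))
    (hC : C.tangentScroll ⊆ grassmannianOfLines (Fin (k + 2) → ℂ)) :
    (∃ Z : RationalNormalCurve (k + 1) (Fin (k + 2) → ℂ),
      linesOf C.points = Z.tangentLines ∧ sweptOut C.points = Z.tangentScroll) ∨
    ∃ θ : Module.Dual ℂ (Fin (k + 2) → ℂ), θ ≠ 0 ∧
      LinearMap.range C.embed ≤
        LinearMap.range (exteriorPower.map 2 (LinearMap.ker θ).subtype) := by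
  set c : Fin (2 * k + 1) → Matrix (Fin (k + 2)) (Fin (k + 2)) ℂ :=
    fun i => bivectorMatrix (k + 2) (C.embed (Pi.single i 1)) with hc
  have hci : LinearIndependent ℂ c := C.linearIndependent_bivectorMatrix
  have hev : ∀ t, (polyMatrix c).map (eval t) = bivectorMatrix (k + 2) (C.vec ![1, t]) :=
    C.polyMatrix_eval_eq
  obtain ⟨a, b, r, h, hM, hab⟩ := exists_directrix hci fun α β t => by
    rw [hev, C.polyMatrix_eval_derivative_eq]
    exact C.exists_wedgeMatrix_of_tangentScroll (by omega) hC α β t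
  have hh : h ≠ 0 := directrix_coeff_ne_zero hci (by rw [Fintype.card_fin]; omega) hM hab
  have hder : ∀ i, derivative (a i) = r * a i + h * b i := fun i => congrFun hab i
  by_cases ha : LinearIndependent ℂ a
  · left
    obtain ⟨hdegh, hdega⟩ := natDegree_le_of_tangent_degree (by omega) ha
      (fun i j => hM ▸ natDegree_polyMatrix_le c i j) hab
    obtain ⟨s, rfl⟩ := natDegree_eq_zero.1 hdegh
    have hs : s ≠ 0 := by rintro rfl; simp at hh
    set Z := ofPolynomials a ha hdega with hZ
    -- By Euler's formula Z₀ + t Z₁ = (k + 1) a with Z₁ = a', so Z₀ ∧ Z₁ = (k + 1) a ∧ a' = (k + 1)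
    -- s a ∧ b.
    have hident : ∀ t, wedgeMatrix (Z.partialVec 0 ![1, t]) (Z.partialVec 1 ![1, t]) =
        ((k + 1 : ℕ) * s : ℂ) • bivectorMatrix (k + 2) (C.vec ![1, t]) := by
      intro t
      have h0 := Z.smul_vec_eq ![1, t]
      rw [← hev, hM]
      rw [hZ, vec_ofPolynomials, partialVec_one_ofPolynomials, ← hZ] at h0
      rw [hZ, partialVec_one_ofPolynomials, ← hZ]
      ext i j
      have h0i := congrFun h0 i
      have h0j := congrFun h0 j
      simp only [Pi.smul_apply, Pi.add_apply, smul_eq_mul, cons_val_zero, cons_val_one,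
        one_mul] at h0i h0j
      have hdi := congrArg (eval t) (hder i)
      have hdj := congrArg (eval t) (hder j)
      simp only [eval_add, eval_mul, eval_C] at hdi hdj
      simp only [wedgeMatrix_apply, Matrix.smul_apply, Matrix.map_apply, smul_eq_mul, eval_sub,
        eval_mul]
      rw [show Z.partialVec 0 ![1, t] i = ((k + 1 : ℕ) : ℂ) * eval t (a i) -
          t * eval t (derivative (a i)) by linear_combination -h0i,
        show Z.partialVec 0 ![1, t] j = ((k + 1 : ℕ) : ℂ) * eval t (a j) -
          t * eval t (derivative (a j)) by linear_combination -h0j, hdi, hdj]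
      ring
    have hlines := linesOf_points_eq C Z (mul_ne_zero (Nat.cast_ne_zero.2 (Nat.succ_ne_zero k)) hs)
      (wedgeMatrix_partialVec_eq C Z hident)
    exact ⟨Z, hlines, sweptOut_points_eq hlines⟩
  · right
    obtain ⟨g, hg, i, hi⟩ := Fintype.not_linearIndependent_iff.1 ha
    let θ : Module.Dual ℂ (Fin (k + 2) → ℂ) := ∑ i, g i • LinearMap.proj i
    have hθ : ∀ x, θ x = ∑ i, g i * x i := fun x => by simp [θ]
    refine ⟨θ, fun h0 => hi ?_, C.range_embed_le fun t => ?_⟩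
    · have := hθ (Pi.single i 1)
      rw [h0] at this
      simpa [Pi.single_apply] using this.symm
    have hg' : ∑ i, Polynomial.C (g i) * a i = 0 := by simpa [Polynomial.smul_eq_C_mul] using hg
    -- Differentiating the relation on a leaves h times the relation on b.
    have hgb : ∑ i, Polynomial.C (g i) * b i = 0 := by
      have h1 : derivative (∑ i, Polynomial.C (g i) * a i) = 0 := by rw [hg', derivative_zero]
      simp only [derivative_sum, derivative_C_mul, hder, mul_add, Finset.sum_add_distrib,
        mul_left_comm _ r, mul_left_comm _ h, ← Finset.mul_sum] at h1
      rw [hg', mul_zero, zero_add] at h1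
      exact (mul_eq_zero.1 h1).resolve_left hh
    have hmem : ∀ x : Fin (k + 2) → ℂ[X], ∑ i, Polynomial.C (g i) * x i = 0 →
        (fun i => (x i).eval t) ∈ LinearMap.ker θ := fun x hx => by
      rw [LinearMap.mem_ker, hθ]
      simpa [eval_finsetSum] using congrArg (eval t) hx
    refine ⟨wedgeBilin _ ⟨_, hmem a hg'⟩ ⟨_, hmem b hgb⟩, ?_⟩
    rw [map_wedgeBilin]
    apply bivectorMatrix_injective
    rw [bivectorMatrix_wedgeBilin, ← hev, hM]
    exact (wedgeMatrix_map (evalRingHom t) a b).symm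

end RationalNormalCurve

/-! ### Irreducibility and dimension in the Zariski topology -/

section Zariski

variable {E : Type*} [AddCommGroup E] [Module ℂ E]

open Filter Topology

/-- The cubic curve with the given coefficients. -/
noncomputable def cubicCurve (c : Fin 4 → E) (t : ℂ) : E := ∑ k : Fin 4, t ^ (k : ℕ) • c k

open Polynomial in
lemma exists_polynomial_eval_cubicCurve (c : Fin 4 → E) (F : MvPolynomial (Module.Dual ℂ E) ℂ) :
    ∃ P : ℂ[X], ∀ t, P.eval t = MvPolynomial.eval (fun f : Module.Dual ℂ E => f (cubicCurve c t)) F := by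
  refine ⟨MvPolynomial.aeval (fun f : Module.Dual ℂ E => ∑ k : Fin 4, C (f (c k)) * X ^ (k : ℕ)) F,
    fun t => ?_⟩
  induction F using MvPolynomial.induction_on with
  | C s => simp
  | add p q hp hq => simp [hp, hq]
  | mul_X p f hp => simp [hp, cubicCurve, eval_finsetSum, mul_comm (t ^ _)]

lemma Projectivization.exists_rep_eq_smul {x : ℙ ℂ E} {v : E}
    (hx : x.submodule = Submodule.span ℂ {v}) : ∃ s : ℂ, s ≠ 0 ∧ x.rep = s • v := by
  have h : x.rep ∈ Submodule.span ℂ {v} := by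
    rw [← hx, x.submodule_eq]; exact Submodule.mem_span_singleton_self _
  obtain ⟨s, hs⟩ := Submodule.mem_span_singleton.1 h
  refine ⟨s, ?_, hs.symm⟩
  rintro rfl
  exact x.rep_nonzero (by rw [← hs, zero_smul])

/-- Rescaling the representative by s multiplies a form of degree n by sⁿ. -/
lemma eval_rep_ne_zero_iff {x : ℙ ℂ E} {v : E} (hx : x.submodule = Submodule.span ℂ {v})
    {F : MvPolynomial (Module.Dual ℂ E) ℂ} {n : ℕ} (hF : F.IsHomogeneous n) :
    MvPolynomial.eval (fun f : Module.Dual ℂ E => f x.rep) F ≠ 0 ↔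
      MvPolynomial.eval (fun f : Module.Dual ℂ E => f v) F ≠ 0 := by
  obtain ⟨s, hs, h⟩ := Projectivization.exists_rep_eq_smul hx
  have e : (fun f : Module.Dual ℂ E => f x.rep) = s • fun f : Module.Dual ℂ E => f v := by
    ext f; simp [h]
  have e2 : MvPolynomial.eval (s • fun f : Module.Dual ℂ E => f v) F =
      s ^ n * MvPolynomial.eval (fun f : Module.Dual ℂ E => f v) F := by
    rw [MvPolynomial.eval_eq, MvPolynomial.eval_eq, Finset.mul_sum]
    refine Finset.sum_congr rfl fun d hd => ?_
    have hdeg : ∑ i ∈ d.support, d i = n := by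
      have := hF (MvPolynomial.mem_support_iff.1 hd)
      rwa [Finsupp.weight_apply, Finsupp.sum, Finset.sum_congr rfl fun i _ => by
        rw [Pi.one_apply, smul_eq_mul, mul_one]] at this
    simp only [Pi.smul_apply, smul_eq_mul, mul_pow, Finset.prod_mul_distrib,
      Finset.prod_pow_eq_pow_sum, hdeg]
    ring
  rw [e, e2]
  simp [hs]

lemma eventually_cubicCurve_ne_zero (c : Fin 4 → E) {t₀ : ℂ} (h : cubicCurve c t₀ ≠ 0) :
    ∀ᶠ t in cofinite, cubicCurve c t ≠ 0 := by
  obtain ⟨f, hf⟩ : ∃ f : Module.Dual ℂ E, f (cubicCurve c t₀) ≠ 0 := by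
    by_contra! hf
    exact h ((Module.forall_dual_apply_eq_zero_iff ℂ _).1 hf)
  obtain ⟨P, hP⟩ := exists_polynomial_eval_cubicCurve c (MvPolynomial.X f)
  simp only [MvPolynomial.eval_X] at hP
  have hP0 : P ≠ 0 := by
    rintro rfl
    exact hf (by rw [← hP]; simp)
  refine (P.rootSet_finite ℂ).subset fun t ht => ?_
  rw [Set.mem_compl_iff, Set.mem_ofPred_eq, not_not] at ht
  rw [Polynomial.mem_rootSet]
  exact ⟨hP0, by simp [hP, ht]⟩

/-- A cubic curve which meets a Zariski open set lies in it up to finitely many points. -/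
lemma eventually_cubicCurve_mem (c : Fin 4 → E) {u : Set (ℙ ℂ E)}
    (hu : IsOpen[zariskiTopology E] u)
    (h : ∃ t₀, ∃ x ∈ u, x.submodule = Submodule.span ℂ {cubicCurve c t₀}) :
    ∀ᶠ t in cofinite, ∃ x ∈ u, x.submodule = Submodule.span ℂ {cubicCurve c t} := by
  have hne : ∀ {t : ℂ} {x : ℙ ℂ E}, x.submodule = Submodule.span ℂ {cubicCurve c t} →
      cubicCurve c t ≠ 0 := fun hx h0 => by
    obtain ⟨s, -, hs⟩ := Projectivization.exists_rep_eq_smul hx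
    exact Projectivization.rep_nonzero _ (by rw [hs, h0, smul_zero])
  change TopologicalSpace.GenerateOpen _ u at hu
  induction hu with
  | basic u hu =>
    obtain ⟨F, n, hF, rfl⟩ := hu
    obtain ⟨t₀, x, hx, hxt⟩ := h
    have hx' := (eval_rep_ne_zero_iff hxt hF).1 hx
    obtain ⟨P, hP⟩ := exists_polynomial_eval_cubicCurve c F
    have hP0 : P ≠ 0 := by
      rintro rfl
      exact hx' (by rw [← hP]; simp)
    have hfin : ∀ᶠ t in cofinite, P.eval t ≠ 0 := by
      refine (P.rootSet_finite ℂ).subset fun t ht => ?_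
      rw [Set.mem_compl_iff, Set.mem_ofPred_eq, not_not] at ht
      rw [Polynomial.mem_rootSet]
      exact ⟨hP0, by simpa using ht⟩
    filter_upwards [hfin, eventually_cubicCurve_ne_zero c (hne hxt)] with t ht h0
    refine ⟨Projectivization.mk ℂ _ h0, ?_, Projectivization.submodule_mk _ _⟩
    exact (eval_rep_ne_zero_iff (Projectivization.submodule_mk _ _) hF).2 (hP t ▸ ht)
  | univ =>
    obtain ⟨t₀, x, -, hxt⟩ := h
    filter_upwards [eventually_cubicCurve_ne_zero c (hne hxt)] with t h0
    exact ⟨Projectivization.mk ℂ _ h0, trivial, Projectivization.submodule_mk _ _⟩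
  | inter u v _ _ ihu ihv =>
    obtain ⟨t₀, x, hx, hxt⟩ := h
    filter_upwards [ihu ⟨t₀, x, hx.1, hxt⟩, ihv ⟨t₀, x, hx.2, hxt⟩] with t h1 h2
    obtain ⟨y, hy, hyt⟩ := h1
    obtain ⟨z, hz, hzt⟩ := h2
    obtain rfl : y = z := Projectivization.submodule_injective (hyt.trans hzt.symm)
    exact ⟨y, ⟨hy, hz⟩, hyt⟩
  | sUnion s _ ih =>
    obtain ⟨t₀, x, ⟨v, hv, hxv⟩, hxt⟩ := h
    filter_upwards [ih v hv ⟨t₀, x, hxv, hxt⟩] with t ht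
    obtain ⟨y, hy, hyt⟩ := ht
    exact ⟨y, ⟨v, hv, hy⟩, hyt⟩

/-- A set whose points can be joined by cubic curves inside the set is irreducible. -/
lemma isPreirreducible_of_cubicCurve {S : Set (ℙ ℂ E)}
    (h : ∀ x ∈ S, ∀ y ∈ S, ∃ c : Fin 4 → E, x.submodule = Submodule.span ℂ {cubicCurve c 0} ∧
      y.submodule = Submodule.span ℂ {cubicCurve c 1} ∧
      ∀ t, ∀ z : ℙ ℂ E, z.submodule = Submodule.span ℂ {cubicCurve c t} → z ∈ S) :
    @IsPreirreducible _ (zariskiTopology E) S := by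
  rintro u v hu hv ⟨x, hxS, hxu⟩ ⟨y, hyS, hyv⟩
  obtain ⟨c, hx, hy, hS⟩ := h x hxS y hyS
  -- Each open set contains all but finitely many points of the curve, and ℂ is infinite.
  obtain ⟨t, ⟨p, hp, hpt⟩, q, hq, hqt⟩ :=
    ((eventually_cubicCurve_mem c hu ⟨0, x, hxu, hx⟩).and
      (eventually_cubicCurve_mem c hv ⟨1, y, hyv, hy⟩)).exists
  obtain rfl : p = q := Projectivization.submodule_injective (hpt.trans hqt.symm)
  exact ⟨p, hS t p hpt, hp, hq⟩

lemma isClosed_projLinear (L : Submodule ℂ E) : IsClosed[zariskiTopology E] (projLinear L) := by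
  let _ := zariskiTopology E
  have e : (projLinear L)ᶜ = ⋃ f ∈ {f : Module.Dual ℂ E | L ≤ LinearMap.ker f},
      {x : ℙ ℂ E | MvPolynomial.eval (fun f : Module.Dual ℂ E => f x.rep) (MvPolynomial.X f) ≠
        0} := by
    ext x
    simp only [Set.mem_compl_iff, projLinear, Set.mem_ofPred_eq, Set.mem_iUnion, exists_prop,
      MvPolynomial.eval_X, x.submodule_eq, Submodule.span_singleton_le_iff_mem]
    constructor
    · intro hx
      obtain ⟨f, hf, hL⟩ := Submodule.exists_le_ker_of_notMem hx
      exact ⟨f, hL, hf⟩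
    · rintro ⟨f, hL, hf⟩ hx
      exact hf (hL hx)
  rw [← isOpen_compl_iff, e]
  exact isOpen_biUnion fun f _ => TopologicalSpace.isOpen_generateFrom_of_mem
    ⟨MvPolynomial.X f, 1, MvPolynomial.isHomogeneous_X _ _, rfl⟩

/-- A chain of irreducible subsets spanning larger and larger linear subspaces bounds the
dimension from below. -/
lemma le_zariskiDim {n : ℕ} {X : Set (ℙ ℂ E)} (S : Fin (n + 1) → Set (ℙ ℂ E))
    (hSX : ∀ i, S i ⊆ X) (hirr : ∀ i, @IsIrreducible _ (zariskiTopology E) (S i))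
    (hmono : Monotone S) (L : Fin n → Submodule ℂ E) (hL : ∀ i, S i.castSucc ⊆ projLinear (L i))
    (hL' : ∀ i, ¬ S i.succ ⊆ projLinear (L i)) : (n : WithBot ℕ∞) ≤ zariskiDim X := by
  let _ := zariskiTopology E
  have hpre : ∀ i, IsIrreducible (Subtype.val ⁻¹' S i : Set X) := by
    intro i
    refine ⟨?_, ?_⟩
    · obtain ⟨x, hx⟩ := (hirr i).1
      exact ⟨⟨x, hSX i hx⟩, hx⟩
    · rintro _ _ ⟨u, hu, rfl⟩ ⟨v, hv, rfl⟩ ⟨x, hx, hxu⟩ ⟨y, hy, hyv⟩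
      obtain ⟨z, hz, hzu, hzv⟩ := (hirr i).2 u v hu hv ⟨x, hx, hxu⟩ ⟨y, hy, hyv⟩
      exact ⟨⟨z, hSX i hz⟩, hz, hzu, hzv⟩
  let Y : Fin (n + 1) → TopologicalSpace.IrreducibleCloseds X := fun i =>
    ⟨closure (Subtype.val ⁻¹' S i), (hpre i).closure, isClosed_closure⟩
  -- The closure of each set stays in the closed linear space P(L i), which the next set leaves.
  have hY : StrictMono Y := by
    rw [Fin.strictMono_iff_lt_succ]
    intro i
    refine lt_of_le_not_ge ?_ ?_
    · exact closure_mono (Set.preimage_mono (hmono (Fin.castSucc_lt_succ (i := i)).le))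
    · intro hle
      apply hL' i
      intro x hx
      have h1 : (⟨x, hSX _ hx⟩ : X) ∈ closure (Subtype.val ⁻¹' S i.castSucc) :=
        hle (subset_closure hx)
      have h2 : closure (Subtype.val ⁻¹' S i.castSucc : Set X) ⊆
          Subtype.val ⁻¹' projLinear (L i) :=
        closure_minimal (Set.preimage_mono (hL i))
          ((isClosed_projLinear (L i)).preimage continuous_subtype_val)
      exact h2 h1
  exact Order.LTSeries.length_le_krullDim (LTSeries.mk n Y hY)

end Zariski

/-! ### Degenerate skew forms -/

section HyperplaneSection

variable {U : Type*} [AddCommGroup U] [Module ℂ U]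

/-- A skew form on a space of odd dimension is degenerate. -/
lemma exists_ne_zero_forall_wedgeBilin [FiniteDimensional ℂ U] (hU : Odd (Module.finrank ℂ U))
    (ψ : ⋀[ℂ]^2 U →ₗ[ℂ] ℂ) : ∃ e : U, e ≠ 0 ∧ ∀ x, ψ (wedgeBilin U x e) = 0 := by
  let b := Module.finBasis ℂ U
  let A : Matrix (Fin (Module.finrank ℂ U)) (Fin (Module.finrank ℂ U)) ℂ :=
    Matrix.of fun i j => ψ (wedgeBilin U (b i) (b j))
  have hA : Aᵀ = -A := by
    ext i j
    simp only [A, transpose_apply, of_apply, Matrix.neg_apply]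
    rw [wedgeBilin_swap, map_neg]
  have hdet : A.det = 0 := by
    have h := det_transpose A
    rw [hA, det_neg, Fintype.card_fin, hU.neg_one_pow, neg_one_mul] at h
    exact self_eq_neg.1 h.symm
  obtain ⟨v, hv, hAv⟩ := exists_mulVec_eq_zero_iff.2 hdet
  refine ⟨∑ j, v j • b j, fun h0 => hv ?_, fun x => ?_⟩
  · exact funext (Fintype.linearIndependent_iff.1 b.linearIndependent v h0)
  · have hb : ∀ i, ψ (wedgeBilin U (b i) (∑ j, v j • b j)) = 0 := fun i => by
      have := congrFun hAv i
      simp only [mulVec, dotProduct, A, of_apply, Pi.zero_apply] at this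
      simp only [map_sum, map_smul, smul_eq_mul, ← this, mul_comm]
    have h0 : (ψ ∘ₗ (wedgeBilin U).flip (∑ j, v j • b j)) = 0 :=
      b.ext fun i => by simpa using hb i
    simpa using LinearMap.congr_fun h0 x

lemma exists_wedgeBilin_ne_zero {ψ : ⋀[ℂ]^2 U →ₗ[ℂ] ℂ} (hψ : ψ ≠ 0) :
    ∃ u w, ψ (wedgeBilin U u w) ≠ 0 := by
  by_contra! h
  apply hψ
  apply exteriorPower.linearMap_ext
  ext v
  simpa [ιMulti_eq_wedgeBilin] using h (v 0) (v 1)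

/-- The transvection-like endomorphism `y ↦ ω(y, w) u - ω(y, u) w`. -/
noncomputable def skewProjection (ψ : ⋀[ℂ]^2 U →ₗ[ℂ] ℂ) (u w : U) : U →ₗ[ℂ] U :=
  (ψ ∘ₗ (wedgeBilin U).flip w).smulRight u - (ψ ∘ₗ (wedgeBilin U).flip u).smulRight w

lemma skewProjection_apply (ψ : ⋀[ℂ]^2 U →ₗ[ℂ] ℂ) (u w y : U) : skewProjection ψ u w y =
    ψ (wedgeBilin U y w) • u - ψ (wedgeBilin U y u) • w := rfl

/-- Consequently, when e lies in the radical of ψ, the bivector (e + s Ty) ∧ y lies in the kernel of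
ψ for every s and y. -/
lemma wedgeBilin_skewProjection_self (ψ : ⋀[ℂ]^2 U →ₗ[ℂ] ℂ) (u w y : U) :
    ψ (wedgeBilin U (skewProjection ψ u w y) y) = 0 := by
  rw [skewProjection_apply, map_sub, LinearMap.sub_apply, map_smul, map_smul,
    LinearMap.smul_apply, LinearMap.smul_apply, wedgeBilin_swap y u, wedgeBilin_swap y w]
  simp only [map_sub, map_smul, map_neg, smul_eq_mul]
  ring

/-- Take y outside the span of e, u, w and adjust it by a multiple of u so that ψ(y ∧ w) = 1. Then
Ty is u minus a multiple of w, and pairing with w separates it from e. -/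
lemma exists_linearIndependent_skewProjection [FiniteDimensional ℂ U]
    (hU : 3 < Module.finrank ℂ U) {ψ : ⋀[ℂ]^2 U →ₗ[ℂ] ℂ} {e u w : U} (he : e ≠ 0)
    (heψ : ∀ x, ψ (wedgeBilin U x e) = 0) (huw : ψ (wedgeBilin U u w) ≠ 0) :
    ∃ y, LinearIndependent ℂ ![e, y, skewProjection ψ u w y] := by
  obtain ⟨y₀, hy₀⟩ : ∃ y₀, y₀ ∉ Submodule.span ℂ (Set.range ![e, u, w]) := by
    by_contra! h
    have h1 : Submodule.span ℂ (Set.range ![e, u, w]) = ⊤ := eq_top_iff.2 fun x _ => h x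
    have h2 := finrank_range_le_card (R := ℂ) ![e, u, w]
    rw [Set.finrank, h1, finrank_top, Fintype.card_fin] at h2
    omega
  set c := (1 - ψ (wedgeBilin U y₀ w)) / ψ (wedgeBilin U u w) with hc
  set y := y₀ + c • u with hy
  have hyw : ψ (wedgeBilin U y w) = 1 := by
    rw [hy, map_add, LinearMap.add_apply, map_smul, LinearMap.smul_apply, map_add, map_smul, hc,
      smul_eq_mul, div_mul_cancel₀ _ huw]
    ring
  have hspan : ∀ a b d : ℂ, a • e + b • u + d • w ∈ Submodule.span ℂ (Set.range ![e, u, w]) :=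
    fun a b d => add_mem (add_mem (Submodule.smul_mem _ _ (Submodule.subset_span ⟨0, rfl⟩))
      (Submodule.smul_mem _ _ (Submodule.subset_span ⟨1, rfl⟩)))
      (Submodule.smul_mem _ _ (Submodule.subset_span ⟨2, rfl⟩))
  refine ⟨y, ?_⟩
  rw [Fintype.linearIndependent_iff]
  intro g hg
  simp only [Fin.sum_univ_three, cons_val, skewProjection_apply, hyw] at hg
  set s := ψ (wedgeBilin U y u)
  have h1 : g 1 = 0 := by
    by_contra h1
    apply hy₀
    have e1 : y₀ = (-(g 1)⁻¹ * g 0) • e + (-(g 1)⁻¹ * g 2 - c) • u +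
        ((g 1)⁻¹ * g 2 * s) • w := by
      have e2 : g 1 • y₀ = -(g 0) • e - (g 2 + g 1 * c) • u + (g 2 * s) • w := by
        rw [hy] at hg
        rw [← sub_eq_zero, ← hg]
        module
      have e3 : y₀ = (g 1)⁻¹ • (g 1 • y₀) := by rw [smul_smul, inv_mul_cancel₀ h1, one_smul]
      rw [e3, e2]
      have h4 : c = (g 1)⁻¹ * g 1 * c := by rw [inv_mul_cancel₀ h1, one_mul]
      conv_rhs => rw [h4]
      module
    rw [e1]
    exact hspan _ _ _
  have hew : ψ (wedgeBilin U e w) = 0 := by rw [wedgeBilin_swap, map_neg, heψ, neg_zero]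
  have h2 : g 2 = 0 := by
    have h3 := congrArg (fun z => ψ (wedgeBilin U z w)) hg
    simp only [map_add, map_sub, map_smul, LinearMap.add_apply, LinearMap.sub_apply,
      LinearMap.smul_apply, h1, zero_smul, hew, smul_zero, one_smul, wedgeBilin_self, map_zero,
      LinearMap.zero_apply, sub_zero, zero_add, smul_eq_mul, mul_zero] at h3
    exact (mul_eq_zero.1 h3).resolve_right huw
  have h0 : g 0 = 0 := by
    rw [h1, h2, zero_smul, zero_smul, add_zero, add_zero] at hg
    exact (smul_eq_zero.1 hg).resolve_right he
  intro i
  fin_cases i <;> assumption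

lemma exists_submodule_gt_finrank_le [FiniteDimensional ℂ U] (K : Submodule ℂ U)
    (hK : Module.finrank ℂ K < Module.finrank ℂ U) :
    ∃ K', K < K' ∧ Module.finrank ℂ K' ≤ Module.finrank ℂ K + 1 := by
  obtain ⟨v, hv⟩ : ∃ v, v ∉ K := by
    by_contra! h
    have h1 : K = ⊤ := eq_top_iff.2 fun x _ => h x
    rw [h1, finrank_top] at hK
    exact lt_irrefl _ hK
  refine ⟨K ⊔ Submodule.span ℂ {v}, ?_, ?_⟩
  · refine lt_of_le_of_ne le_sup_left fun h => hv ?_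
    rw [h]
    exact (le_sup_right : _ ≤ K ⊔ _) (Submodule.mem_span_singleton_self v)
  · exact (Submodule.finrank_add_le_finrank_add_finrank _ _).trans
      (Nat.add_le_add_left (by simpa using finrank_span_le_card (R := ℂ) ({v} : Set U)) _)

end HyperplaneSection

/-! ### Hyperplane sections of G(2,5) -/

section Degenerate

variable {m : ℕ}

lemma wedgeBilin_ne_zero {x y : Fin m → ℂ} (h : LinearIndependent ℂ ![x, y]) :
    wedgeBilin _ x y ≠ 0 := by
  intro h0
  have h1 := range_mulVecLin_wedgeMatrix h
  rw [← bivectorMatrix_wedgeBilin, h0, map_zero] at h1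
  have h2 : x ∈ Submodule.span ℂ {x, y} := Submodule.subset_span (by simp)
  rw [← h1] at h2
  obtain ⟨ξ, hξ⟩ := h2
  exact h.ne_zero 0 (by simpa using hξ.symm)

/-- A decomposable bivector divisible by `e` comes from a plane through `e`. -/
lemma wedgeBilin_ne_of_linearIndependent {e x y : Fin m → ℂ} (h : LinearIndependent ℂ ![e, y, x])
    (z : Fin m → ℂ) : wedgeBilin _ x y ≠ wedgeBilin _ e z := by
  intro h0
  have h1 := congrArg (bivectorMatrix m) h0
  rw [bivectorMatrix_wedgeBilin, bivectorMatrix_wedgeBilin] at h1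
  obtain ⟨ξ, hξ⟩ := h.exists_dotProduct_eq ![1, 0, 0]
  have he := hξ 0
  have hy := hξ 1
  have hx := hξ 2
  simp only [cons_val] at he hy hx
  have h2 := congrArg (· *ᵥ ξ) h1
  simp only [wedgeMatrix_mulVec, he, hy, hx, zero_smul, sub_zero, one_smul] at h2
  have hz : z = (z ⬝ᵥ ξ) • e := (sub_eq_zero.1 h2.symm).symm
  have h3 : wedgeBilin _ e z = 0 := by rw [hz, map_smul, wedgeBilin_self, smul_zero]
  have h4 : LinearIndependent ℂ ![x, y] := by
    have := h.comp ![2, 1] (by decide)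
    convert this using 1
    ext i; fin_cases i <;> rfl
  exact wedgeBilin_ne_zero h4 (h0.trans h3)

lemma mem_grassmannianOfLines {x : ℙ ℂ (⋀[ℂ]^2 (Fin m → ℂ))} {a b : Fin m → ℂ}
    (h : x.submodule = Submodule.span ℂ {wedgeBilin _ a b}) :
    x ∈ grassmannianOfLines (Fin m → ℂ) := by
  have h0 : wedgeBilin _ a b ≠ 0 := fun h0 => by
    obtain ⟨s, -, hs⟩ := Projectivization.exists_rep_eq_smul h
    exact x.rep_nonzero (by rw [hs, h0, smul_zero])
  refine ⟨Submodule.span ℂ {a, b}, a, b, ?_, rfl, h⟩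
  apply linearIndependent_of_wedgeMatrix_ne_zero
  intro h1
  rw [← bivectorMatrix_wedgeBilin] at h1
  exact h0 (bivectorMatrix_injective (by rw [h1, map_zero]))

variable {U : Submodule ℂ (Fin m → ℂ)}

/-- The bivector `(e + s T y) ∧ y` for the parameters `q = (s, y)`. -/
noncomputable def bivectorFamily (e : U) (T : U →ₗ[ℂ] U) (q : ℂ × U) : ⋀[ℂ]^2 (Fin m → ℂ) :=
  wedgeBilin _ ((e + q.1 • T q.2 : U) : Fin m → ℂ) (q.2 : Fin m → ℂ)

/-- The points of the Grassmannian given by a family of bivectors. -/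
def bivectorFamilyPoints (e : U) (T : U →ₗ[ℂ] U) (A : Submodule ℂ (ℂ × U)) :
    Set (ℙ ℂ (⋀[ℂ]^2 (Fin m → ℂ))) :=
  {x | ∃ q ∈ A, x.submodule = Submodule.span ℂ {bivectorFamily e T q}}

/-- The term s Ty ∧ y is linear in s and quadratic in y; this is the source of the cubics. -/
lemma bivectorFamily_line (e : U) (T : U →ₗ[ℂ] U) (q d : ℂ × U) : ∃ c,
    ∀ t : ℂ, bivectorFamily e T (q + t • d) = cubicCurve c t := by
  let B : U → U → ⋀[ℂ]^2 (Fin m → ℂ) := fun x y => wedgeBilin _ (x : Fin m → ℂ) (y : Fin m → ℂ)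
  refine ⟨![B e q.2 + q.1 • B (T q.2) q.2,
    B e d.2 + d.1 • B (T q.2) q.2 + q.1 • (B (T d.2) q.2 + B (T q.2) d.2),
    d.1 • (B (T d.2) q.2 + B (T q.2) d.2) + q.1 • B (T d.2) d.2,
    d.1 • B (T d.2) d.2], fun t => ?_⟩
  simp only [bivectorFamily, cubicCurve, Fin.sum_univ_four, cons_val, B, Prod.fst_add,
    Prod.snd_add, Prod.smul_fst, Prod.smul_snd, map_add, map_smul, Submodule.coe_add,
    Submodule.coe_smul, LinearMap.add_apply, LinearMap.smul_apply, smul_eq_mul]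
  simp only [Fin.val_zero, Fin.val_one, Fin.val_two, pow_zero, pow_one, one_smul]
  have h3 : ((3 : Fin 4) : ℕ) = 3 := rfl
  rw [h3]
  module

lemma isPreirreducible_bivectorFamilyPoints (e : U) (T : U →ₗ[ℂ] U) (A : Submodule ℂ (ℂ × U)) :
    @IsPreirreducible _ (zariskiTopology _) (bivectorFamilyPoints e T A) := by
  apply isPreirreducible_of_cubicCurve
  rintro x ⟨q, hq, hx⟩ y ⟨q', hq', hy⟩
  obtain ⟨c, hc⟩ := bivectorFamily_line e T q (q' - q)
  refine ⟨c, ?_, ?_, fun t z hz => ⟨q + t • (q' - q), ?_, ?_⟩⟩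
  · rw [← hc, zero_smul, add_zero, hx]
  · rw [← hc, one_smul, add_sub_cancel, hy]
  · exact add_mem hq (Submodule.smul_mem _ _ (sub_mem hq' hq))
  · rw [hc, hz]

/-- Hyperplane sections of the Grassmannian of lines of `𝐏⁴` have dimension at least `4`. -/
theorem four_le_zariskiDim (hU : Module.finrank ℂ U = 5) {ψ : ⋀[ℂ]^2 U →ₗ[ℂ] ℂ} (hψ : ψ ≠ 0)
    {W : Submodule ℂ (⋀[ℂ]^2 (Fin m → ℂ))}
    (hW : ∀ v, ψ v = 0 → exteriorPower.map 2 U.subtype v ∈ W) :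
    4 ≤ zariskiDim (grassmannianOfLines (Fin m → ℂ) ∩ projLinear W) := by
  obtain ⟨e, he, heψ⟩ := exists_ne_zero_forall_wedgeBilin (hU ▸ by decide) ψ
  obtain ⟨u, w, huw⟩ := exists_wedgeBilin_ne_zero hψ
  obtain ⟨y, hy⟩ := exists_linearIndependent_skewProjection (by omega) he heψ huw
  set T := skewProjection ψ u w with hT
  have h1 : Module.finrank ℂ (Submodule.span ℂ {e}) = 1 := finrank_span_singleton he
  obtain ⟨K₀, hK₀, hf₀⟩ := exists_submodule_gt_finrank_le (Submodule.span ℂ {e}) (by omega)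
  obtain ⟨K₁, hK₁, hf₁⟩ := exists_submodule_gt_finrank_le K₀ (by omega)
  obtain ⟨K₂, hK₂, hf₂⟩ := exists_submodule_gt_finrank_le K₁ (by omega)
  obtain ⟨K₃, hK₃, hf₃⟩ := exists_submodule_gt_finrank_le K₂ (by omega)
  let K : Fin 4 → Submodule ℂ U := ![K₀, K₁, K₂, K₃]
  have hK : StrictMono K := by
    rw [Fin.strictMono_iff_lt_succ]
    intro i
    fin_cases i
    exacts [hK₁, hK₂, hK₃]
  have heK : ∀ i, Submodule.span ℂ {e} ≤ K i := fun i =>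
    hK₀.le.trans (hK.monotone (Fin.zero_le i))
  -- The chain consists of the four linear spaces P(e ∧ K i), with e in each K i, followed by the
  -- whole family, where s is also free.
  let A : Fin 5 → Submodule ℂ (ℂ × U) := Fin.snoc (fun i => Submodule.prod ⊥ (K i)) ⊤
  have hA : ∀ i : Fin 4, A i.castSucc = Submodule.prod ⊥ (K i) := fun i =>
    Fin.snoc_castSucc (α := fun _ => Submodule ℂ (ℂ × U)) _ _ i
  have hA4 : A (Fin.last 4) = ⊤ := Fin.snoc_last (α := fun _ => Submodule ℂ (ℂ × U)) _ _
  have hAmono : Monotone A := by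
    rw [Fin.monotone_iff_le_succ]
    intro i
    rw [hA]
    refine Fin.lastCases ?_ (fun i => ?_) i
    · rw [Fin.succ_last, hA4]; exact le_top
    · rw [Fin.succ_castSucc, hA]
      exact Submodule.prod_mono le_rfl (hK.monotone (Fin.castSucc_lt_succ (i := i)).le)
  have hcoe : ∀ {k : ℕ} {v : Fin k → U}, LinearIndependent ℂ v →
      LinearIndependent ℂ fun i => (v i : Fin m → ℂ) := fun hv =>
    hv.map' U.subtype U.ker_subtype
  have hwe : ∀ z : U, z ∉ Submodule.span ℂ {e} →
      wedgeBilin _ (e : Fin m → ℂ) (z : Fin m → ℂ) ≠ 0 := by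
    intro z hz
    apply wedgeBilin_ne_zero
    have h2 : LinearIndependent ℂ ![e, z] := by
      rw [LinearIndependent.pair_iff' he]
      exact fun s hs => hz (Submodule.mem_span_singleton.2 ⟨s, hs⟩)
    convert hcoe h2 using 1
    ext i; fin_cases i <;> rfl
  have hfam0 : ∀ z : U, bivectorFamily e T (0, z) = wedgeBilin _ (e : Fin m → ℂ) (z : Fin m → ℂ) :=
    fun z => by simp [bivectorFamily]
  let N : Fin 4 → Submodule ℂ (⋀[ℂ]^2 (Fin m → ℂ)) := fun i =>
    (K i).map (wedgeBilin _ (e : Fin m → ℂ) ∘ₗ U.subtype)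
  have hpoint : ∀ {q : ℂ × U} {B : Submodule ℂ (ℂ × U)} (_ : q ∈ B)
      (h : bivectorFamily e T q ≠ 0), Projectivization.mk ℂ _ h ∈ bivectorFamilyPoints e T B :=
    fun hq h => ⟨_, hq, Projectivization.submodule_mk _ _⟩
  refine le_zariskiDim (n := 4) (fun i => bivectorFamilyPoints e T (A i)) ?_ ?_ ?_ N ?_ ?_
  · rintro i x ⟨q, -, hx⟩
    refine ⟨mem_grassmannianOfLines hx, ?_⟩
    change x.submodule ≤ W
    rw [hx, Submodule.span_singleton_le_iff_mem]
    have e1 : bivectorFamily e T q =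
        exteriorPower.map 2 U.subtype (wedgeBilin U (e + q.1 • T q.2) q.2) := by
      rw [map_wedgeBilin]; rfl
    rw [e1]
    apply hW
    rw [map_add, LinearMap.add_apply, map_smul, LinearMap.smul_apply, map_add, map_smul,
      wedgeBilin_skewProjection_self, wedgeBilin_swap, map_neg, heψ]
    simp
  · intro i
    refine ⟨?_, isPreirreducible_bivectorFamilyPoints e T _⟩
    obtain ⟨z, hzK, hz⟩ := Set.exists_of_ssubset hK₀
    have h0 : bivectorFamily e T (0, z) ≠ 0 := by rw [hfam0]; exact hwe z hz
    refine ⟨_, hpoint (hAmono (Fin.zero_le i) ?_) h0⟩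
    have := hA 0
    rw [Fin.castSucc_zero] at this
    rw [this]
    exact ⟨Submodule.zero_mem _, hzK⟩
  · rintro i j hij x ⟨q, hq, hx⟩
    exact ⟨q, hAmono hij hq, hx⟩
  · rintro i x ⟨⟨s, z⟩, hq, hx⟩
    rw [hA] at hq
    obtain ⟨hs, hz⟩ := hq
    obtain rfl : s = 0 := hs
    change x.submodule ≤ _
    rw [hx, Submodule.span_singleton_le_iff_mem, hfam0]
    exact ⟨z, hz, rfl⟩
  · intro i hsub
    suffices h : ∃ q ∈ A i.succ, bivectorFamily e T q ∉ N i by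
      obtain ⟨q, hq, hqN⟩ := h
      have h0 : bivectorFamily e T q ≠ 0 := fun h0 => hqN (h0 ▸ zero_mem _)
      have := hsub (hpoint hq h0)
      change Submodule.span ℂ {_} ≤ _ at this
      rw [Submodule.span_singleton_le_iff_mem] at this
      exact hqN this
    revert hsub
    refine Fin.lastCases ?_ (fun i => ?_) i
    · intro _
      -- If (e + Ty) ∧ y = e ∧ z, then Ty ∧ y = e ∧ (z − y), impossible for independent e, y, Ty.
      refine ⟨(1, y), by rw [Fin.succ_last, hA4]; trivial, ?_⟩
      rintro ⟨z, -, hz⟩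
      have h2 : LinearIndependent ℂ ![(e : Fin m → ℂ), (y : Fin m → ℂ), (T y : Fin m → ℂ)] := by
        convert hcoe hy using 1
        ext i; fin_cases i <;> rfl
      apply wedgeBilin_ne_of_linearIndependent h2 ((z - y : U) : Fin m → ℂ)
      have h3 : wedgeBilin _ (e : Fin m → ℂ) (z : Fin m → ℂ) =
          wedgeBilin _ (e : Fin m → ℂ) (y : Fin m → ℂ) +
            wedgeBilin _ (T y : Fin m → ℂ) (y : Fin m → ℂ) := by
        refine hz.trans ?_
        simp [bivectorFamily]
      rw [Submodule.coe_sub, map_sub, h3]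
      abel
    · intro _
      obtain ⟨z, hzK, hz⟩ := Set.exists_of_ssubset (hK (Fin.castSucc_lt_succ (i := i)))
      refine ⟨(0, z), by rw [Fin.succ_castSucc, hA]; exact ⟨Submodule.zero_mem _, hzK⟩, ?_⟩
      rintro ⟨z', hz', h2⟩
      rw [hfam0] at h2
      have h3 : wedgeBilin _ (e : Fin m → ℂ) ((z - z' : U) : Fin m → ℂ) = 0 := by
        rw [Submodule.coe_sub, map_sub, ← h2]
        exact sub_self _
      have h4 : z - z' ∈ Submodule.span ℂ {e} := by
        by_contra h4
        exact hwe _ h4 h3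
      apply hz
      have := add_mem (heK _ h4) hz'
      rwa [sub_add_cancel] at this

end Degenerate

/-! ### Excluding the hyperplane case -/

lemma finrank_range_embed {V : Type*} [AddCommGroup V] [Module ℂ V] {d : ℕ}
    (C : RationalNormalCurve d V) : Module.finrank ℂ (LinearMap.range C.embed) = d + 1 := by
  rw [LinearMap.finrank_range_of_inj C.embed_injective, Module.finrank_fin_fun]

lemma finrank_ker_dual {V : Type*} [AddCommGroup V] [Module ℂ V] [FiniteDimensional ℂ V]
    {θ : Module.Dual ℂ V} (hθ : θ ≠ 0) :
    Module.finrank ℂ (LinearMap.ker θ) + 1 = Module.finrank ℂ V := by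
  have h := θ.finrank_range_add_finrank_ker
  rw [LinearMap.range_eq_top.2 (LinearMap.surjective hθ), finrank_top, Module.finrank_self] at h
  omega

lemma map_subtype_injective {V : Type*} [AddCommGroup V] [Module ℂ V] (U : Submodule ℂ V) :
    Function.Injective (exteriorPower.map (R := ℂ) 2 U.subtype) :=
  exteriorPower.map_injective_field U.subtype_injective

/-- A subspace of codimension one of the bivectors of `U` is the kernel of a functional. -/
lemma exists_functional_of_finrank_range {V : Type*} [AddCommGroup V] [Module ℂ V]
    {U : Submodule ℂ V} [FiniteDimensional ℂ U] {P : Submodule ℂ (⋀[ℂ]^2 V)}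
    (hP : P ≤ LinearMap.range (exteriorPower.map 2 U.subtype))
    (hfin : Module.finrank ℂ P + 1 = Module.finrank ℂ (⋀[ℂ]^2 U)) :
    ∃ ψ : ⋀[ℂ]^2 U →ₗ[ℂ] ℂ, ψ ≠ 0 ∧ ∀ v, ψ v = 0 → exteriorPower.map 2 U.subtype v ∈ P := by
  set j := exteriorPower.map (R := ℂ) 2 U.subtype with hj
  have h1 : Module.finrank ℂ (P.comap j) = Module.finrank ℂ P := by
    conv_rhs => rw [← Submodule.map_comap_eq_of_le hP]
    exact (Submodule.equivMapOfInjective j (map_subtype_injective U) _).finrank_eq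
  have hlt : P.comap j < ⊤ := by
    rw [lt_top_iff_ne_top]
    intro h
    rw [h, finrank_top] at h1
    omega
  obtain ⟨ψ, hψ, hle⟩ := Submodule.exists_le_ker_of_lt_top _ hlt
  refine ⟨ψ, hψ, fun v hv => ?_⟩
  have heq : P.comap j = LinearMap.ker ψ := by
    apply Submodule.eq_of_le_of_finrank_eq hle
    have := finrank_ker_dual hψ
    omega
  have : v ∈ P.comap j := heq ▸ hv
  exact this

lemma range_embed_le_of_tangentScroll {V : Type*} [AddCommGroup V] [Module ℂ V] {d : ℕ}
    (hd : d ≠ 0) (C : RationalNormalCurve d V) {W : Submodule ℂ V}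
    (h : C.tangentScroll ⊆ projLinear W) : LinearMap.range C.embed ≤ W := by
  apply C.range_embed_le
  intro t
  have hp : (![1, t] : Fin 2 → ℂ) ≠ 0 := fun h0 => by simpa using congrFun h0 0
  have hmem : Projectivization.mk ℂ (C.vec ![1, t]) (C.vec_ne_zero hp) ∈ C.tangentScroll := by
    refine Set.mem_biUnion (x := C.tangentLine ![1, t]) ⟨_, hp, rfl⟩ ?_
    change Submodule.span ℂ {_} ≤ _
    rw [Submodule.span_singleton_le_iff_mem]
    refine (Submodule.smul_mem_iff _ (Nat.cast_ne_zero.2 hd)).1 (?_ : (d : ℂ) • _ ∈ _)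
    rw [C.smul_vec_eq]
    exact add_mem (Submodule.smul_mem _ _ (Submodule.subset_span (by simp)))
      (Submodule.smul_mem _ _ (Submodule.subset_span (by simp)))
  have := h hmem
  change Submodule.span ℂ {_} ≤ _ at this
  rwa [Submodule.span_singleton_le_iff_mem] at this

theorem mainTheorem4 :
    (∀ C : RationalNormalCurve 6 (⋀[ℂ]^2 (Fin 5 → ℂ)),
      C.points ⊆ grassmannianOfLines (Fin 5 → ℂ) →
      C.tangentScroll ⊆ grassmannianOfLines (Fin 5 → ℂ) →
      ∃ Z : RationalNormalCurve 4 (Fin 5 → ℂ),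
        linesOf C.points = Z.tangentLines ∧ sweptOut C.points = Z.tangentScroll) ∧
    (∀ C : RationalNormalCurve 8 (⋀[ℂ]^2 (Fin 6 → ℂ)),
      C.points ⊆ grassmannianOfLines (Fin 6 → ℂ) →
      C.tangentScroll ⊆ grassmannianOfLines (Fin 6 → ℂ) →
      (∃ W : Submodule ℂ (⋀[ℂ]^2 (Fin 6 → ℂ)), Module.finrank ℂ W = 10 ∧
        zariskiDim (grassmannianOfLines (Fin 6 → ℂ) ∩ projLinear W) = 3 ∧
        C.tangentScroll ⊆ grassmannianOfLines (Fin 6 → ℂ) ∩ projLinear W) →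
      ∃ Z : RationalNormalCurve 5 (Fin 6 → ℂ),
        linesOf C.points = Z.tangentLines ∧ sweptOut C.points = Z.tangentScroll) := by
  constructor
  · intro C _ hC
    refine (RationalNormalCurve.tangentLines_or_hyperplane (k := 3) (by norm_num) C hC).resolve_right
      ?_
    rintro ⟨θ, hθ, hle⟩
    have h1 := Submodule.finrank_mono hle
    have h2 := finrank_ker_dual hθ
    rw [Module.finrank_fin_fun] at h2
    have h3 : Module.finrank ℂ (LinearMap.ker θ) = 4 := by omega
    rw [finrank_range_embed, LinearMap.finrank_range_of_inj (map_subtype_injective _),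
      exteriorPower.finrank_eq, h3] at h1
    -- The inequality reads 7 ≤ 6.
    exact absurd h1 (by decide)
  · intro C _ hC hW
    refine (RationalNormalCurve.tangentLines_or_hyperplane (k := 4) (by norm_num) C hC).resolve_right
      ?_
    rintro ⟨θ, hθ, hle⟩
    obtain ⟨W, -, hdim, hscroll⟩ := hW
    have h2 := finrank_ker_dual hθ
    rw [Module.finrank_fin_fun] at h2
    have h3 : Module.finrank ℂ (LinearMap.ker θ) = 5 := by omega
    -- The span of the curve has dimension 9, one less than that of ⋀²ℂ⁵.
    obtain ⟨ψ, hψ, hker⟩ := exists_functional_of_finrank_range hle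
      (by rw [finrank_range_embed, exteriorPower.finrank_eq, h3]; rfl)
    have h4 := four_le_zariskiDim h3 hψ fun v hv =>
      range_embed_le_of_tangentScroll (by norm_num) C
        (hscroll.trans Set.inter_subset_right) (hker v hv)
    rw [hdim] at h4
    exact absurd h4 (by decide)
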